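/- **Setting.** Let $\mathcal X\subset\mathbb R^d$ and $\mathcal Y\subset\mathbb R^{d'}$ be compact convex sets with nonempty interior, $\mathbb P$ a probability measure on $\mathcal Z$, and $f:\mathcal X\times\mathcal Y\times\mathcal Z\to\mathbb R$ with $f(x,y;\cdot)$ integrable. Put $F(x,y)=\mathbb E_{z\sim\mathbb P}f(x,y;z)$, $\Phi(x)=\max_{y\in\mathcal Y}F(x,y)$ and, for an i.i.d. sample $S=(z_1,\dots,z_n)\sim\mathbb P^n$, $F_S(x,y)=\frac1n\sum_i f(x,y;z_i)$, $\Phi_S(x)=\max_{y\in\mathcal Y}F_S(x,y)$. Assume, with constants $\beta,\mu_x,\mu_y,B_{x^*},B_{y^*}>0$: * for every $z$, $f(\cdot,\cdot;z)$ is differentiable with $\beta$-Lipschitz gradient on $\mathcal X\times\mathcal Y$, and $f(x,\cdot;z)$ is $\mu_y$-strongly concave on $\mathcal Y$ for every $x\in\mathcal X$; * ($x$-side PL condition) $F(x,y)-\inf_{x'\in\mathcal X}F(x',y)\le\frac1{2\mu_x}\|\nabla_xF(x,y)\|^2$ for all $x\in\mathcal X$, $y\in\mathcal Y$; * $(x^*,y^*)$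 is the solution of $\min_{x\in\mathcal X}\max_{y\in\mathcal Y}F(x,y)$, and it is unique; * the constraint $x\in\mathcal X$ does not obstruct gradient descent on $\Phi$: for every $x\in\mathcal X$ there is $\eta>0$ with $x-\eta\nabla\Phi(x)\in\mathcal X$; * (Bernstein condition) for all integers $k\ge2$, $\mathbb E\|\nabla_xf(x^*,y^*;z)\|^k\le\frac{k!}2\,\mathbb E\|\nabla_xf(x^*,y^*;z)\|^2\,B_{x^*}^{k-2}$ and $\mathbb E\|\nabla_yf(x^*,y^*;z)\|^k\le\frac{k!}2\,\mathbb E\|\nabla_yf(x^*,y^*;z)\|^2\,B_{y^*}^{k-2}$, all these moments being finite; * $\|x-x^*\|\le R_1$ for all $x\in\mathcal X$. A pair $(\hat x^*,\hat y^*)$ is an empirical saddle point (ESP) if $\hat x^*\in\mathcal X$ minimizes $\Phi_S$ over $\mathcal X$ and $\hat y^*\in\mathcal Y$ maximizes $F_S(\hat x^*,\cdot)$ over $\mathcal Y$. **Theorem.** There is an absolute constant $c>0$ such that the following holds in this setting. Call $(n,\delta)$ admissible if $R_1n\ge1$ and $$n\ \ge\ \frac{c\,\beta^2(\mu_y+\beta)^4\Big(d+\log\frac{16\log_2(\sqrt2R_1n+1)}{\delta}\Big)}{\mu_y^4\mu_x^2}.$$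 1. For every $\delta\in(0,1)$ and $n$ with $(n,\delta)$ admissible, with probability at least $1-\delta$ every ESP satisfies $$\Phi(\hat x^*)-\Phi(x^*)\le\frac{12\beta^2\,\mathbb E\|\nabla_yf(x^*,y^*;z)\|^2\log\frac8\delta}{\mu_x\mu_y^2n}+\frac{12\,\mathbb E\|\nabla_xf(x^*,y^*;z)\|^2\log\frac8\delta}{\mu_xn}+\frac{3\Big(\frac{2\beta B_{y^*}}{\mu_y}\log\frac8\delta+2B_{x^*}\log\frac8\delta+\mu_x\Big)^2}{2\mu_xn^2}.$$ 2. Suppose moreover that $f\ge0$ on $\mathcal X\times\mathcal Y\times\mathcal Z$, and let $\delta_0\in(0,1)$. Then there is a constant $K$, independent of $n$ and $\delta$, such that for all admissible $(n,\delta)$ with $0<\delta\le\delta_0$, with probability at least $1-\delta$ every ESP satisfies $$\Phi(\hat x^*)-\Phi(x^*)\le K\Big(\frac{\Phi(x^*)\log\frac1\delta}{n}+\frac{\log^2\frac1\delta}{n^2}\Big).$$ For every $M$ there is a constant $K$, independent of $n$ and $\delta$, such that for all such $(n,\delta)$ with $\Phi(x^*)\le M/n$, with probability at least $1-\delta$ every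 ESP satisfies $\Phi(\hat x^*)-\Phi(x^*)\le K\,\frac{\log^2(1/\delta)}{n^2}$. 3. If, for every $z$, $f(\cdot,\cdot;z)$ is defined, nonnegative and $\beta$-smooth on all of $\mathbb R^d\times\mathbb R^{d'}$, then the constants $K$ in part 2 can be chosen to depend only on $\beta,\mu_x,\mu_y,B_{x^*},B_{y^*},\delta_0$ (and, for the second bound, $M$). -/

import Mathlib

open MeasureTheory

universe u

noncomputable section

namespace Minimax

/-- The Euclidean space of dimension `d`. -/
abbrev E (d : ℕ) : Type := EuclideanSpace ℝ (Fin d)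

section Objective

variable {d d' : ℕ} {Z : Type*}

/-- The partial gradient of `f(·, y; z)` at `x`, relative to the constraint set `X`. -/
def gradX (X : Set (E d)) (f : E d → E d' → Z → ℝ) (x : E d) (y : E d') (z : Z) : E d :=
  gradientWithin (fun x' => f x' y z) X x

/-- The partial gradient of `f(x, ·; z)` at `y`, relative to the constraint set `Y`. -/
def gradY (Y : Set (E d')) (f : E d → E d' → Z → ℝ) (x : E d) (y : E d') (z : Z) : E d' :=
  gradientWithin (fun y' => f x y' z) Y y

/-- `f` is `β`-smooth in `(x, y) ∈ X × Y`, for every `z`: differentiable, with a joint gradient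
that is `β`-Lipschitz for the Euclidean norm of the product (both sides are squared). -/
def IsSmoothOn (β : ℝ) (X : Set (E d)) (Y : Set (E d')) (f : E d → E d' → Z → ℝ) : Prop :=
  ∀ z : Z,
    DifferentiableOn ℝ (fun p : E d × E d' => f p.1 p.2 z) (X ×ˢ Y) ∧
    ∀ x₁ ∈ X, ∀ x₂ ∈ X, ∀ y₁ ∈ Y, ∀ y₂ ∈ Y,
      ‖gradX X f x₁ y₁ z - gradX X f x₂ y₂ z‖ ^ 2
          + ‖gradY Y f x₁ y₁ z - gradY Y f x₂ y₂ z‖ ^ 2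
        ≤ β ^ 2 * (‖x₁ - x₂‖ ^ 2 + ‖y₁ - y₂‖ ^ 2)

/-- The population risk `F(x, y) = 𝔼 f(x, y; z)`. -/
def popRisk [MeasurableSpace Z] (P : Measure Z) (f : E d → E d' → Z → ℝ)
    (x : E d) (y : E d') : ℝ :=
  ∫ z, f x y z ∂P

/-- The empirical risk `F_S(x, y) = (1/n) ∑ᵢ f(x, y; zᵢ)`. -/
def empRisk {n : ℕ} (f : E d → E d' → Z → ℝ) (S : Fin n → Z) (x : E d) (y : E d') : ℝ :=
  (1 / (n : ℝ)) * ∑ i, f x y (S i)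

/-- The primal function `x ↦ max_{y ∈ Y} G(x, y)`. -/
def primal (Y : Set (E d')) (G : E d → E d' → ℝ) (x : E d) : ℝ :=
  sSup ((fun y => G x y) '' Y)

/-- `(x, y)` solves `min_{x ∈ X} max_{y ∈ Y} G(x, y)`. -/
def IsMinimaxSol (X : Set (E d)) (Y : Set (E d')) (G : E d → E d' → ℝ)
    (x : E d) (y : E d') : Prop :=
  x ∈ X ∧ y ∈ Y ∧ IsMinOn (primal Y G) X x ∧ IsMaxOn (fun y' => G x y') Y y

/-- The `x`-side Polyak-Lojasiewicz condition with parameter `μ` on `X`, for every `y ∈ Y`. -/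
def IsPLX (μ : ℝ) (X : Set (E d)) (Y : Set (E d')) (G : E d → E d' → ℝ) : Prop :=
  ∀ y ∈ Y, ∀ x ∈ X,
    G x y - sInf ((fun x' => G x' y) '' X)
      ≤ 1 / (2 * μ) * ‖gradientWithin (fun x' => G x' y) X x‖ ^ 2

/-- Bernstein's moment condition with parameter `B` for the random vector `g`. -/
def Bernstein {V : Type*} [NormedAddCommGroup V] [MeasurableSpace Z] (P : Measure Z)
    (g : Z → V) (B : ℝ) : Prop :=
  ∀ k : ℕ, 2 ≤ k →
    Integrable (fun z => ‖g z‖ ^ k) P ∧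
    ∫ z, ‖g z‖ ^ k ∂P ≤ (k.factorial : ℝ) / 2 * (∫ z, ‖g z‖ ^ 2 ∂P) * B ^ (k - 2)

/-- The standing assumptions: a PL-strongly-concave stochastic minimax problem with optimal
solution `(xs, ys)`. -/
structure Setting [MeasurableSpace Z] (X : Set (E d)) (Y : Set (E d')) (P : Measure Z)
    (f : E d → E d' → Z → ℝ) (β μx μy Bx By R₁ : ℝ) (xs : E d) (ys : E d') : Prop where
  β_pos : 0 < β
  μx_pos : 0 < μx
  μy_pos : 0 < μy
  Bx_pos : 0 < Bx
  By_pos : 0 < By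
  compact_X : IsCompact X
  convex_X : Convex ℝ X
  /-- gradients relative to `X` are determined -/
  interior_X : (interior X).Nonempty
  compact_Y : IsCompact Y
  convex_Y : Convex ℝ Y
  /-- gradients relative to `Y` are determined -/
  interior_Y : (interior Y).Nonempty
  prob : IsProbabilityMeasure P
  integrable : ∀ x ∈ X, ∀ y ∈ Y, Integrable (fun z => f x y z) P
  smooth : IsSmoothOn β X Y f
  strongConcave : ∀ x ∈ X, ∀ z : Z, StrongConcaveOn Y μy (fun y => f x y z)
  pl : IsPLX μx X Y (popRisk P f)
  /-- the optimal solution of the population problem -/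
  sol : IsMinimaxSol X Y (popRisk P f) xs ys
  /-- it is the only one (`ys` is determined by `xs`) -/
  unique : ∀ x ∈ X, primal Y (popRisk P f) x = primal Y (popRisk P f) xs → x = xs
  /-- the constraint `x ∈ X` does not obstruct descent on the primal function -/
  descent : ∀ x ∈ X, ∃ η : ℝ, 0 < η ∧ x - η • gradientWithin (primal Y (popRisk P f)) X x ∈ X
  bernstein_x : Bernstein P (fun z => gradX X f xs ys z) Bx
  bernstein_y : Bernstein P (fun z => gradY Y f xs ys z) By
  radius : ∀ x ∈ X, ‖x - xs‖ ≤ R₁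

/-- The sample size `n` is large. The condition `1 ≤ R₁ n` only keeps the iterated logarithm
from degenerating, and can always be met by enlarging the radius `R₁`. -/
def LargeSample (c β μx μy R₁ : ℝ) (d n : ℕ) (δ : ℝ) : Prop :=
  1 ≤ R₁ * n ∧
  c * β ^ 2 * (μy + β) ^ 4
      * (d + Real.log (16 * Real.logb 2 (Real.sqrt 2 * R₁ * n + 1) / δ))
      / (μy ^ 4 * μx ^ 2) ≤ n

/-- With probability at least `1 - δ` over an i.i.d. sample `S` of size `n`, every solution
`(xh, yh)` of the empirical problem has excess primal risk at most `b`. (The failure event is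
measured by the outer measure, so it is contained in a measurable event of probability `≤ δ`.) -/
def ExcessRiskBound [MeasurableSpace Z] (X : Set (E d)) (Y : Set (E d')) (P : Measure Z)
    (f : E d → E d' → Z → ℝ) (xs : E d) (n : ℕ) (δ b : ℝ) : Prop :=
  Measure.pi (fun _ : Fin n => P)
      {S : Fin n → Z | ∃ xh yh, IsMinimaxSol X Y (empRisk f S) xh yh ∧
        ¬ primal Y (popRisk P f) xh - primal Y (popRisk P f) xs ≤ b}
    ≤ ENNReal.ofReal δ

end Objective

end Minimax

end

noncomputable section

namespace Minimax

/-! ### Bernstein's inequality for norms of sums of independent random vectors. -/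

section Bernstein

open Real

/-! Write `y*(x)` for the maximizer of `F(x, ·)`. Strong concavity makes `y*` Lipschitz with
constant `β/μy`, so `Φ` has gradient `∇ₓF(x, y*(x))` with a quadratic remainder
(`SCSmooth.primal_expand`). It inherits the PL inequality from `F`. Together with feasible descent
and uniqueness of the minimizer, PL gives quadratic growth (`quadratic_growth`), hence `μx‖x - x*‖ ≤
‖∇Φ(x)‖`.

At an ESP `(x̂, ŷ)`, test the first-order condition for `Φ_S` in the feasible direction `-∇Φ(x̂)`.
This yields `⟨∇ₓF_S(x̂, ŷ), ∇Φ(x̂)⟩ ≤ 0`, so `‖∇Φ(x̂)‖` is at most the distance between the two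
gradients. Stability of the argmax replaces `ŷ` by `y*(x̂)`, which leaves the deviations of the
empirical partial gradients at `(x̂, y*(x̂))`, the `y` one with weight `β/μy`
(`norm_primal_gradient_le`). Evaluating at the population maximizer matters: the point no longer
depends on the sample except through `x̂`.

Those gradients are Lipschitz fields in `x` alone, with constant `β(1 + β/μy)`. Chaining over nets
in dimension `d`, then peeling over dyadic shells around `x*`, bounds the deviation at `x` by the
one at `x*` plus `ε max(‖x - x*‖, 1/n)`, uniformly in `x` (`measure_exists_dev_gt_le`). For a large
sample `ε` is so small that quadratic growth absorbs this term into `‖∇Φ(x̂)‖`. Only the deviations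
at `(x*, y*)` remain; Bernstein's condition controls them, and the PL inequality turns the gradient
bound into the excess risk bound.

All tails come from `measure_norm_sum_ge_le`, a dimension-free exponential bound obtained by
following the expectation of `cosh` of the norm of the partial sums.

For nonnegative `f`, the second moments at the optimum are at most a multiple of `Φ(x*)`. With
smoothness on the whole space the multiple is `2β`, by self-bounding. Otherwise it is a ratio when
`Φ(x*) > 0`, and when `Φ(x*) = 0` both moments vanish. -/

theorem cosh_le_of_sq_eq_convex_comb {a b p q r : ℝ} (ha : 0 ≤ a) (hb : 0 ≤ b) (hab : a + b = 1)
    (h : r ^ 2 = a * p ^ 2 + b * q ^ 2) : cosh r ≤ a * cosh p + b * cosh q := by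
  -- As a power series in the square of its argument, `cosh` has nonnegative coefficients, so it is
  -- convex in that square.
  refine hasSum_le (fun n => ?_) (hasSum_cosh r)
    (((hasSum_cosh p).mul_left a).add ((hasSum_cosh q).mul_left b))
  have key : (r ^ 2) ^ n ≤ a * (p ^ 2) ^ n + b * (q ^ 2) ^ n := by
    rw [h]
    have := (convexOn_pow (𝕜 := ℝ) n).2 (sq_nonneg p) (sq_nonneg q) ha hb hab
    simpa [smul_eq_mul] using this
  rw [pow_mul, pow_mul, pow_mul, ← mul_div_assoc, ← mul_div_assoc, ← add_div]
  gcongr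

variable {V : Type*} [NormedAddCommGroup V] [InnerProductSpace ℝ V]

/-- If `e` is the cosine of the angle between `s` and `w`, then `‖s + w‖²` is the convex combination
of `(‖s‖ ± ‖w‖)²` with weights `(1 ± e)/2`. Convexity of `cosh` in the square reduces the claim to
`(cosh ‖s‖ - e sinh ‖s‖)(sinh ‖w‖ - ‖w‖) ≥ 0`. -/
theorem cosh_norm_add_le (s w : V) :
    cosh ‖s + w‖ ≤ cosh ‖s‖ + sinh ‖s‖ / ‖s‖ * inner ℝ s w
      + cosh ‖s‖ * (exp ‖w‖ - 1 - ‖w‖) := by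
  have hsw : ‖w‖ ≤ sinh ‖w‖ := self_le_sinh_iff.2 (norm_nonneg w)
  have hexp : exp ‖w‖ = cosh ‖w‖ + sinh ‖w‖ := (cosh_add_sinh _).symm
  rcases eq_or_ne s 0 with rfl | hs
  · simp only [zero_add, norm_zero, inner_zero_left, cosh_zero, mul_zero, add_zero, one_mul]
    linarith
  rcases eq_or_ne w 0 with rfl | hw
  · simp
  have ha : 0 < ‖s‖ := norm_pos_iff.2 hs
  have hb : 0 < ‖w‖ := norm_pos_iff.2 hw
  have hc := abs_le.1 (abs_real_inner_le_norm s w)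
  set a := ‖s‖
  set b := ‖w‖
  set c := inner ℝ s w
  obtain ⟨e, he⟩ : ∃ e, e = c / (a * b) := ⟨_, rfl⟩
  have hce : c = e * (a * b) := by rw [he]; field_simp
  have he1 : e ≤ 1 := by rw [he, div_le_one (by positivity)]; exact hc.2
  have he2 : -1 ≤ e := by rw [he, le_div_iff₀ (by positivity)]; linarith [hc.1]
  have h1 : ‖s + w‖ ^ 2 = (1 + e) / 2 * (a + b) ^ 2 + (1 - e) / 2 * (a - b) ^ 2 := by
    rw [norm_add_sq_real]
    change a ^ 2 + 2 * c + b ^ 2 = _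
    rw [hce]; ring
  have h2 := cosh_le_of_sq_eq_convex_comb (by linarith) (by linarith) (by ring) h1
  have h3 : sinh a / a * c = e * b * sinh a := by rw [hce]; field_simp
  rw [h3, hexp]
  rw [cosh_add, cosh_sub] at h2
  have h4 : 0 ≤ cosh a - e * sinh a := by
    have := sinh_lt_cosh a
    nlinarith [sinh_nonneg_iff.2 ha.le]
  nlinarith [mul_nonneg h4 (sub_nonneg.2 hsw)]

/-- The left side is the tangent at `s` of the convex function `cosh ‖·‖`. -/
theorem cosh_norm_add_ge (s w : V) :
    cosh ‖s‖ + sinh ‖s‖ / ‖s‖ * inner ℝ s w ≤ cosh ‖s + w‖ := by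
  rcases eq_or_ne s 0 with rfl | hs
  · simp
  have ha : 0 < ‖s‖ := norm_pos_iff.2 hs
  have h1 : ‖s‖ ^ 2 + inner ℝ s w ≤ ‖s‖ * ‖s + w‖ := by
    have := real_inner_le_norm s (s + w)
    rwa [inner_add_right, real_inner_self_eq_norm_sq] at this
  have hsinh := sinh_nonneg_iff.2 ha.le
  have h2 : sinh ‖s‖ / ‖s‖ * inner ℝ s w ≤ sinh ‖s‖ * (‖s + w‖ - ‖s‖) := by
    rw [div_mul_eq_mul_div, div_le_iff₀ ha]
    nlinarith
  have h3 : cosh ‖s + w‖ = cosh ‖s‖ * cosh (‖s + w‖ - ‖s‖) + sinh ‖s‖ * sinh (‖s + w‖ - ‖s‖) := by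
    rw [← cosh_add]; congr 1; ring
  set t := ‖s + w‖ - ‖s‖
  have h4 : sinh ‖s‖ * t ≤ cosh ‖s‖ * (cosh t - 1) + sinh ‖s‖ * sinh t := by
    have hc : sinh ‖s‖ ≤ cosh ‖s‖ := (sinh_lt_cosh _).le
    have hct : 0 ≤ cosh t - 1 := by linarith [one_le_cosh t]
    have : t ≤ cosh t - 1 + sinh t := by
      rw [show cosh t - 1 + sinh t = exp t - 1 by rw [← cosh_add_sinh]; ring]
      linarith [add_one_le_exp t]
    nlinarith
  linarith

variable {Z : Type*} [MeasurableSpace Z] {P : Measure Z}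

theorem hasSum_exp_tail (x : ℝ) :
    HasSum (fun k : ℕ => x ^ (k + 2) / ((k + 2).factorial : ℝ)) (exp x - 1 - x) := by
  have h := NormedSpace.expSeries_div_hasSum_exp (𝔸 := ℝ) x
  rw [← Real.exp_eq_exp_ℝ] at h
  have := (hasSum_nat_add_iff' 2).2 h
  simpa [Finset.sum_range_succ, sub_sub] using this

/-- Integrate the exponential series termwise: the factorials of the moment condition cancel and
leave a geometric series in `B`. -/
theorem integral_exp_tail_le {V : Type*} [NormedAddCommGroup V]
    [IsProbabilityMeasure P] {W : Z → V} (hW : AEStronglyMeasurable W P)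
    {σ B : ℝ} (hB : 0 ≤ B) (hB1 : B < 1)
    (hmom : ∀ k : ℕ, 2 ≤ k → Integrable (fun z => ‖W z‖ ^ k) P ∧
      ∫ z, ‖W z‖ ^ k ∂P ≤ (k.factorial : ℝ) / 2 * σ ^ 2 * B ^ (k - 2)) :
    Integrable (fun z => exp ‖W z‖ - 1 - ‖W z‖) P ∧
      ∫ z, (exp ‖W z‖ - 1 - ‖W z‖) ∂P ≤ σ ^ 2 / (2 * (1 - B)) := by
  have hnn : ∀ z, 0 ≤ exp ‖W z‖ - 1 - ‖W z‖ := fun z => by linarith [add_one_le_exp ‖W z‖]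
  have hm : AEStronglyMeasurable (fun z => exp ‖W z‖ - 1 - ‖W z‖) P := by
    have : Continuous fun v : V => exp ‖v‖ - 1 - ‖v‖ := by fun_prop
    exact this.comp_aestronglyMeasurable hW
  have hl : ∫⁻ z, ENNReal.ofReal (exp ‖W z‖ - 1 - ‖W z‖) ∂P
      ≤ ENNReal.ofReal (σ ^ 2 / (2 * (1 - B))) := by
    have e1 : ∀ z, ENNReal.ofReal (exp ‖W z‖ - 1 - ‖W z‖)
        = ∑' k : ℕ, ENNReal.ofReal (‖W z‖ ^ (k + 2) / ((k + 2).factorial : ℝ)) := fun z => by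
      rw [← (hasSum_exp_tail ‖W z‖).tsum_eq,
        ENNReal.ofReal_tsum_of_nonneg (fun k => by positivity) (hasSum_exp_tail ‖W z‖).summable]
    simp_rw [e1]
    rw [lintegral_tsum (fun k => ((hW.norm.aemeasurable.pow_const _).div_const _).ennreal_ofReal)]
    have hgeo : HasSum (fun k : ℕ => σ ^ 2 / 2 * B ^ k) (σ ^ 2 / (2 * (1 - B))) := by
      have := (hasSum_geometric_of_lt_one hB hB1).mul_left (σ ^ 2 / 2)
      rwa [← div_eq_mul_inv, div_div] at this
    rw [← hgeo.tsum_eq, ENNReal.ofReal_tsum_of_nonneg (fun k => by positivity) hgeo.summable]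
    refine ENNReal.tsum_le_tsum fun k => ?_
    obtain ⟨hi, hle⟩ := hmom (k + 2) (by omega)
    rw [← ofReal_integral_eq_lintegral_ofReal (hi.div_const _)
      (Filter.Eventually.of_forall fun z => by positivity), integral_div]
    refine ENNReal.ofReal_le_ofReal ?_
    rw [div_le_iff₀ (by positivity)]
    refine hle.trans (le_of_eq ?_)
    rw [Nat.add_sub_cancel]; ring
  have hint : Integrable (fun z => exp ‖W z‖ - 1 - ‖W z‖) P := by
    refine ⟨hm, ?_⟩
    rw [hasFiniteIntegral_iff_ofReal (Filter.Eventually.of_forall hnn)]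
    exact hl.trans_lt ENNReal.ofReal_lt_top
  refine ⟨hint, ?_⟩
  have hpos : 0 ≤ σ ^ 2 / (2 * (1 - B)) := div_nonneg (sq_nonneg _) (by linarith)
  rw [← ofReal_integral_eq_lintegral_ofReal hint (Filter.Eventually.of_forall hnn)] at hl
  exact (ENNReal.ofReal_le_ofReal_iff hpos).1 hl

/-- The one-step bound holds for every starting point `s`, so it can be iterated by splitting off
one sample at a time. Lower integrals avoid any integrability question. -/
theorem lintegral_cosh_sum {V : Type*} [NormedAddCommGroup V]
    [IsProbabilityMeasure P] {V' : Z → V} (hV : AEStronglyMeasurable V' P)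
    {q : ℝ} (hq : 0 ≤ q)
    (hstep : ∀ s : V, ∫⁻ z, ENNReal.ofReal (cosh ‖s + V' z‖) ∂P ≤ ENNReal.ofReal (q * cosh ‖s‖))
    (n : ℕ) (s : V) :
    ∫⁻ S, ENNReal.ofReal (cosh ‖s + ∑ i, V' (S i)‖) ∂(Measure.pi fun _ : Fin n => P)
      ≤ ENNReal.ofReal (q ^ n * cosh ‖s‖) := by
  induction n generalizing s with
  | zero => simp
  | succ n ih =>
    have hmp := (measurePreserving_piFinSuccAbove (fun _ : Fin (n + 1) => P) 0).symm
    have hcont : Continuous fun v : V => ENNReal.ofReal (cosh ‖s + v‖) :=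
      ENNReal.continuous_ofReal.comp (by fun_prop)
    rw [← hmp.lintegral_comp_emb (MeasurableEquiv.measurableEmbedding _)]
    have hm : AEStronglyMeasurable (fun p : Z × (Fin n → Z) => V' p.1 + ∑ i, V' (p.2 i))
        (P.prod (Measure.pi fun _ : Fin n => P)) := by
      refine AEStronglyMeasurable.add ?_ ?_
      · exact hV.comp_quasiMeasurePreserving Measure.quasiMeasurePreserving_fst
      · refine (Finset.aestronglyMeasurable_fun_sum _ fun i _ => ?_)
        exact hV.comp_quasiMeasurePreserving
          ((Measure.quasiMeasurePreserving_eval _ i).comp Measure.quasiMeasurePreserving_snd)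
    have e1 : ∀ p : Z × (Fin n → Z), ENNReal.ofReal (cosh ‖s + ∑ i, V'
        ((MeasurableEquiv.piFinSuccAbove (fun _ : Fin (n + 1) => Z) 0).symm p i)‖)
        = ENNReal.ofReal (cosh ‖s + (V' p.1 + ∑ i, V' (p.2 i))‖) := fun p => by
      rw [Fin.sum_univ_succ]; rfl
    simp_rw [e1]
    rw [lintegral_prod _ (hcont.comp_aestronglyMeasurable hm).aemeasurable]
    calc ∫⁻ z, ∫⁻ S, ENNReal.ofReal (cosh ‖s + (V' z + ∑ i, V' (S i))‖)
          ∂(Measure.pi fun _ : Fin n => P) ∂P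
        ≤ ∫⁻ z, ENNReal.ofReal (q ^ n) * ENNReal.ofReal (cosh ‖s + V' z‖) ∂P := by
          refine lintegral_mono fun z => ?_
          simp_rw [← add_assoc]
          rw [← ENNReal.ofReal_mul (by positivity)]
          exact ih _
      _ ≤ ENNReal.ofReal (q ^ n) * ENNReal.ofReal (q * cosh ‖s‖) := by
          rw [lintegral_const_mul' _ _ ENNReal.ofReal_ne_top]
          gcongr
          exact hstep s
      _ = _ := by rw [← ENNReal.ofReal_mul (by positivity), ← mul_assoc, pow_succ]

theorem integrable_of_integrable_norm_sq {V : Type*} [NormedAddCommGroup V]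
    [IsProbabilityMeasure P] {W : Z → V}
    (hW : AEStronglyMeasurable W P) (h : Integrable (fun z => ‖W z‖ ^ 2) P) : Integrable W P := by
  refine Integrable.mono' (g := fun z => 1 + ‖W z‖ ^ 2) ((integrable_const _).add h) hW
    (Filter.Eventually.of_forall fun z => ?_)
  nlinarith [sq_nonneg (‖W z‖ - 1)]

theorem norm_integral_le_of_second_moment {V : Type*} [NormedAddCommGroup V]
    [NormedSpace ℝ V] [IsProbabilityMeasure P] {W : Z → V}
    (hW : AEStronglyMeasurable W P) (h : Integrable (fun z => ‖W z‖ ^ 2) P) {σ : ℝ} (hσ : 0 ≤ σ)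
    (hle : ∫ z, ‖W z‖ ^ 2 ∂P ≤ σ ^ 2) : ‖∫ z, W z ∂P‖ ≤ σ := by
  have hi := integrable_of_integrable_norm_sq hW h
  have h1 := norm_integral_le_integral_norm (μ := P) W
  set m := ∫ z, ‖W z‖ ∂P
  have hm : 0 ≤ m := integral_nonneg fun z => norm_nonneg _
  have h2 : 0 ≤ ∫ z, (‖W z‖ ^ 2 - 2 * m * ‖W z‖ + m ^ 2) ∂P :=
    integral_nonneg fun z => show 0 ≤ ‖W z‖ ^ 2 - 2 * m * ‖W z‖ + m ^ 2 by
      nlinarith [sq_nonneg (‖W z‖ - m)]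
  have h3 : Integrable (fun z => 2 * m * ‖W z‖) P := hi.norm.const_mul _
  have h4 : Integrable (fun z => ‖W z‖ ^ 2 - 2 * m * ‖W z‖) P := h.sub h3
  rw [integral_add h4 (integrable_const _), integral_sub h h3, integral_const_mul] at h2
  simp only [integral_const, probReal_univ, one_smul] at h2
  have : m ^ 2 ≤ σ ^ 2 := by
    change 0 ≤ _ - 2 * m * m + m ^ 2 at h2
    nlinarith
  exact h1.trans (abs_le_of_sq_le_sq' this hσ).2

variable [CompleteSpace V]

/-- The moment condition concerns the uncentered `W`. Expanding around `s - m` instead of `s` makes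
the uncentered `W` the increment; the price is the factor `exp σ`, because `‖m‖ ≤ σ`. -/
theorem lintegral_cosh_step [IsProbabilityMeasure P] {W : Z → V} (hW : AEStronglyMeasurable W P)
    {σ B : ℝ} (hσ : 0 ≤ σ) (hB : 0 ≤ B) (hB1 : B < 1)
    (hmom : ∀ k : ℕ, 2 ≤ k → Integrable (fun z => ‖W z‖ ^ k) P ∧
      ∫ z, ‖W z‖ ^ k ∂P ≤ (k.factorial : ℝ) / 2 * σ ^ 2 * B ^ (k - 2)) (s : V) :
    ∫⁻ z, ENNReal.ofReal (cosh ‖s + (W z - ∫ z', W z' ∂P)‖) ∂P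
      ≤ ENNReal.ofReal ((1 + exp σ * (σ ^ 2 / (2 * (1 - B)))) * cosh ‖s‖) := by
  obtain ⟨hE, hEle⟩ := integral_exp_tail_le hW hB hB1 hmom
  obtain ⟨h2, h2le⟩ := hmom 2 le_rfl
  have hi := integrable_of_integrable_norm_sq hW h2
  have hmσ : ‖∫ z, W z ∂P‖ ≤ σ := norm_integral_le_of_second_moment hW h2 hσ (by simpa using h2le)
  set m := ∫ z', W z' ∂P
  set ψ := σ ^ 2 / (2 * (1 - B))
  have hψ : 0 ≤ ψ := div_nonneg (sq_nonneg _) (by linarith)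
  set c := sinh ‖s - m‖ / ‖s - m‖
  have hpt : ∀ z, cosh ‖s + (W z - m)‖ ≤ cosh ‖s - m‖ + c * inner ℝ (s - m) (W z)
      + cosh ‖s - m‖ * (exp ‖W z‖ - 1 - ‖W z‖) := fun z => by
    have := cosh_norm_add_le (s - m) (W z)
    rwa [show s - m + W z = s + (W z - m) by abel] at this
  have hin : Integrable (fun z => inner ℝ (s - m) (W z)) P := hi.const_inner _
  have hR1 : Integrable (fun z => cosh ‖s - m‖ + c * inner ℝ (s - m) (W z)) P :=
    (integrable_const _).add (hin.const_mul _)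
  have hR : Integrable (fun z => cosh ‖s - m‖ + c * inner ℝ (s - m) (W z)
      + cosh ‖s - m‖ * (exp ‖W z‖ - 1 - ‖W z‖)) P := hR1.add (hE.const_mul _)
  refine (lintegral_mono fun z => ENNReal.ofReal_le_ofReal (hpt z)).trans ?_
  rw [← ofReal_integral_eq_lintegral_ofReal hR (Filter.Eventually.of_forall fun z =>
    (cosh_pos _).le.trans (hpt z))]
  refine ENNReal.ofReal_le_ofReal ?_
  rw [integral_add hR1 (hE.const_mul _), integral_add (integrable_const _) (hin.const_mul _),
    integral_const_mul, integral_const_mul, integral_inner hi]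
  simp only [integral_const, probReal_univ, one_smul]
  -- The linear term integrates to the tangent increment from `s - m` in direction `m`, so convexity
  -- brings it back below `cosh ‖s‖`.
  have h3 := cosh_norm_add_ge (s - m) m
  rw [sub_add_cancel] at h3
  have h4 : cosh ‖s - m‖ ≤ exp σ * cosh ‖s‖ := by
    have h5 : ‖s - m‖ ≤ ‖s‖ + σ := (norm_sub_le _ _).trans (by linarith)
    have h6 : cosh ‖s - m‖ ≤ cosh (‖s‖ + σ) := by
      rw [cosh_le_cosh, abs_of_nonneg (norm_nonneg _), abs_of_nonneg (by positivity)]; exact h5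
    refine h6.trans ?_
    rw [cosh_add, ← cosh_add_sinh σ]
    nlinarith [sinh_nonneg_iff.2 hσ, (sinh_lt_cosh ‖s‖).le]
  have h7 : cosh ‖s - m‖ * ∫ z, (exp ‖W z‖ - 1 - ‖W z‖) ∂P ≤ exp σ * cosh ‖s‖ * ψ :=
    mul_le_mul h4 hEle (integral_nonneg fun z =>
      show 0 ≤ exp ‖W z‖ - 1 - ‖W z‖ by linarith [add_one_le_exp ‖W z‖])
      (by positivity)
  change _ + c * inner ℝ (s - m) m + _ ≤ _
  linarith

/-- Exponential tail bound for the norm of a sum of independent copies of a random vector whose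
(uncentered) moments satisfy Bernstein's condition. -/
theorem measure_norm_sum_ge_le [IsProbabilityMeasure P] {W : Z → V}
    (hW : AEStronglyMeasurable W P) {σ B lam : ℝ} (hσ : 0 ≤ σ) (hB : 0 ≤ B) (hlam : 0 ≤ lam)
    (hB1 : lam * B < 1)
    (hmom : ∀ k : ℕ, 2 ≤ k → Integrable (fun z => ‖W z‖ ^ k) P ∧
      ∫ z, ‖W z‖ ^ k ∂P ≤ (k.factorial : ℝ) / 2 * σ ^ 2 * B ^ (k - 2)) (n : ℕ) (t : ℝ) :
    Measure.pi (fun _ : Fin n => P) {S | t ≤ ‖∑ i, (W (S i) - ∫ z, W z ∂P)‖}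
      ≤ ENNReal.ofReal (2 * exp (n * (exp (lam * σ) * ((lam * σ) ^ 2 / (2 * (1 - lam * B))))
          - lam * t)) := by
  set m := ∫ z, W z ∂P
  have hWs : AEStronglyMeasurable (fun z => lam • W z) P := hW.const_smul lam
  have hstep := lintegral_cosh_step hWs (mul_nonneg hlam hσ) (mul_nonneg hlam hB) hB1
    (fun k hk => by
      obtain ⟨h1, h2⟩ := hmom k hk
      have e : ∀ z, ‖lam • W z‖ ^ k = lam ^ k * ‖W z‖ ^ k := fun z => by
        rw [norm_smul, Real.norm_of_nonneg hlam, mul_pow]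
      simp_rw [e]
      refine ⟨h1.const_mul _, ?_⟩
      rw [integral_const_mul]
      refine (mul_le_mul_of_nonneg_left h2 (by positivity)).trans (le_of_eq ?_)
      obtain ⟨j, rfl⟩ := Nat.exists_eq_add_of_le hk
      rw [Nat.add_sub_cancel_left, mul_pow, mul_pow, pow_add]; ring)
  rw [integral_smul] at hstep
  set ψ := exp (lam * σ) * ((lam * σ) ^ 2 / (2 * (1 - lam * B)))
  have hψ : 0 ≤ ψ := mul_nonneg (exp_pos _).le (div_nonneg (sq_nonneg _) (by linarith))
  have hVm : AEStronglyMeasurable (fun z => lam • W z - lam • m) P :=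
    hWs.sub aestronglyMeasurable_const
  have h0 := lintegral_cosh_sum hVm (by linarith : (0 : ℝ) ≤ 1 + ψ) hstep n 0
  have hsum : AEStronglyMeasurable (fun S : Fin n → Z => ∑ i, (lam • W (S i) - lam • m))
      (Measure.pi fun _ : Fin n => P) :=
    Finset.aestronglyMeasurable_fun_sum _ fun i _ =>
      hVm.comp_quasiMeasurePreserving (Measure.quasiMeasurePreserving_eval _ i)
  have hcont : Continuous fun v : V => ENNReal.ofReal (cosh ‖0 + v‖) :=
    ENNReal.continuous_ofReal.comp (by fun_prop)
  -- Markov's inequality with `cosh u ≥ exp u / 2`, the source of the factor 2.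
  have hmark := meas_ge_le_lintegral_div (μ := Measure.pi fun _ : Fin n => P)
    (hcont.comp_aestronglyMeasurable hsum).aemeasurable
    (ε := ENNReal.ofReal (exp (lam * t) / 2)) (by simp [exp_pos]) ENNReal.ofReal_ne_top
  refine (measure_mono fun S hS => ?_).trans (hmark.trans ((ENNReal.div_le_div_right h0 _).trans ?_))
  · simp only [Set.mem_ofPred_eq] at hS ⊢
    refine ENNReal.ofReal_le_ofReal ?_
    have e : ‖(0 : V) + ∑ i, (lam • W (S i) - lam • m)‖ = lam * ‖∑ i, (W (S i) - m)‖ := by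
      simp_rw [← smul_sub]
      rw [← Finset.smul_sum, zero_add, norm_smul, Real.norm_of_nonneg hlam]
    rw [e, cosh_eq]
    have := exp_le_exp.2 (mul_le_mul_of_nonneg_left hS hlam)
    have := exp_pos (-(lam * ‖∑ i, (W (S i) - m)‖))
    linarith
  · rw [← ENNReal.ofReal_div_of_pos (by positivity)]
    refine ENNReal.ofReal_le_ofReal ?_
    rw [norm_zero, cosh_zero, mul_one, exp_sub, div_div_eq_mul_div, mul_comm, ← mul_div_assoc]
    gcongr
    rw [exp_nat_mul]
    gcongr
    linarith [add_one_le_exp ψ]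

/-- The exponential bound with `lam = w/(σ + Bw)`, for which the exponent collapses to `-n w²/2`.
The parameter `κ` bounds the factor `exp (lam σ)` caused by the lack of centering. -/
theorem measure_norm_sum_gt_le [IsProbabilityMeasure P] {W : Z → V}
    (hW : AEStronglyMeasurable W P) {σ B w κ : ℝ} (hσ : 0 ≤ σ) (hB : 0 ≤ B) (hw : 0 ≤ w)
    (hκ : exp (w * σ / (σ + B * w)) ≤ κ)
    (hmom : ∀ k : ℕ, 2 ≤ k → Integrable (fun z => ‖W z‖ ^ k) P ∧
      ∫ z, ‖W z‖ ^ k ∂P ≤ (k.factorial : ℝ) / 2 * σ ^ 2 * B ^ (k - 2)) (n : ℕ) :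
    Measure.pi (fun _ : Fin n => P)
        {S | n * ((1 + κ) / 2 * σ * w + B * w ^ 2 / 2) < ‖∑ i, (W (S i) - ∫ z, W z ∂P)‖}
      ≤ ENNReal.ofReal (2 * exp (-(n * w ^ 2 / 2))) := by
  -- The choice of `lam` is written with `w/σ`. If `σ = 0`, then `W` vanishes almost surely and the
  -- event is null.
  rcases hσ.eq_or_lt with rfl | hσ
  · obtain ⟨h2, h2le⟩ := hmom 2 le_rfl
    have h0 : ∫ z, ‖W z‖ ^ 2 ∂P = 0 :=
      le_antisymm (by simpa using h2le) (integral_nonneg fun z => sq_nonneg _)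
    rw [integral_eq_zero_iff_of_nonneg (fun z => sq_nonneg _) h2] at h0
    have hW0 : ∀ᵐ z ∂P, W z = 0 := by
      filter_upwards [h0] with z hz
      simpa using hz
    have hm0 : ∫ z, W z ∂P = 0 := by rw [integral_congr_ae hW0]; simp
    have hall : ∀ᵐ S ∂(Measure.pi fun _ : Fin n => P), ∀ i, W (S i) = 0 :=
      ae_all_iff.2 fun i => (Measure.quasiMeasurePreserving_eval (fun _ : Fin n => P) i).ae hW0
    rw [measure_eq_zero_iff_ae_notMem.2]
    · exact zero_le
    filter_upwards [hall] with S hS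
    simp only [hS, hm0, sub_zero, Finset.sum_const_zero, norm_zero, not_lt]
    have : 0 ≤ κ := (exp_pos _).le.trans hκ
    positivity
  set a := w / σ with ha
  have ha0 : 0 ≤ a := by positivity
  have h1 : 0 < 1 + a * B := by positivity
  set lam := a / (1 + a * B) with hlam
  have hlam0 : 0 ≤ lam := by positivity
  have hlB : 1 - lam * B = 1 / (1 + a * B) := by rw [hlam]; field_simp; ring
  have hlσ : lam * σ = w * σ / (σ + B * w) := by
    rw [hlam, ha]; field_simp
  have hmain := measure_norm_sum_ge_le hW hσ.le hB hlam0
    (by have : 0 < 1 - lam * B := by rw [hlB]; positivity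
        linarith) hmom n (n * ((1 + κ) / 2 * σ * w + B * w ^ 2 / 2))
  refine (measure_mono fun S hS => ?_).trans (hmain.trans (ENNReal.ofReal_le_ofReal ?_))
  · simp only [Set.mem_ofPred_eq] at hS ⊢
    exact hS.le
  have e1 : (lam * σ) ^ 2 / (2 * (1 - lam * B)) = lam * σ * w / 2 := by
    rw [hlB, hlam, ha]; field_simp
  have e2 : lam * (σ + B * w) = w := by
    rw [hlam, ha]; field_simp
  rw [e1]
  gcongr 2 * exp ?_
  have h2 : exp (lam * σ) * (lam * σ * w / 2) ≤ κ * (lam * σ * w / 2) :=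
    mul_le_mul_of_nonneg_right (hlσ ▸ hκ) (by positivity)
  have h3 := mul_le_mul_of_nonneg_left h2 n.cast_nonneg (α := ℝ)
  refine (sub_le_sub_right h3 _).trans (le_of_eq ?_)
  linear_combination (-(n * w / 2 : ℝ)) * e2

end Bernstein

/-! ### Nets, chaining and peeling in Euclidean space. -/

section Chaining

open Real Metric

variable {d : ℕ}

/-- Volume comparison: the disjoint balls of radius `η/2` around the points all lie in one ball of
radius `r + η/2`. -/
theorem card_le_of_separated_subset_closedBall (s : Finset (E d)) (x₀ : E d) {r η : ℝ}
    (hη : 0 < η) (hr : 0 ≤ r) (hs : ∀ c ∈ s, ‖c - x₀‖ ≤ r)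
    (h : ∀ c ∈ s, ∀ c' ∈ s, c ≠ c' → η ≤ ‖c - c'‖) : (s.card : ℝ) ≤ (1 + 2 * r / η) ^ d := by
  let μ : Measure (E d) := volume
  set A := ⋃ c ∈ s, ball (c : E d) (η / 2) with hA
  have D : Set.Pairwise (s : Set (E d)) (Function.onFun Disjoint fun c => ball (c : E d) (η / 2)) := by
    rintro c hc c' hc' hcd
    apply ball_disjoint_ball
    rw [dist_eq_norm, add_halves]
    exact h c hc c' hc' hcd
  have A_subset : A ⊆ ball x₀ (r + η / 2) := by
    refine Set.iUnion₂_subset fun x hx => ball_subset_ball' ?_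
    rw [dist_eq_norm, add_comm]
    exact add_le_add_left (hs x hx) _
  have hδ : 0 < η / 2 := by positivity
  have hρ : 0 < r + η / 2 := by positivity
  have I : (s.card : ENNReal) * ENNReal.ofReal ((η / 2) ^ d) * μ (ball 0 1)
      ≤ ENNReal.ofReal ((r + η / 2) ^ d) * μ (ball 0 1) :=
    calc (s.card : ENNReal) * ENNReal.ofReal ((η / 2) ^ d) * μ (ball 0 1) = μ A := by
          rw [hA, measure_biUnion_finset D fun c _ => measurableSet_ball]
          simp only [μ.addHaar_ball_of_pos _ hδ, Finset.sum_const, nsmul_eq_mul, mul_assoc,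
            finrank_euclideanSpace, Fintype.card_fin]
      _ ≤ μ (ball x₀ (r + η / 2)) := measure_mono A_subset
      _ = _ := by
          simp only [μ.addHaar_ball_of_pos _ hρ, finrank_euclideanSpace, Fintype.card_fin]
  have J := (ENNReal.mul_le_mul_iff_left (measure_ball_pos μ _ zero_lt_one).ne'
    measure_ball_lt_top.ne).1 I
  have K := ENNReal.toReal_le_of_le_ofReal (by positivity) J
  rw [ENNReal.toReal_mul, ENNReal.toReal_natCast, ENNReal.toReal_ofReal (by positivity)] at K
  have e : (r + η / 2) ^ d = (1 + 2 * r / η) ^ d * (η / 2) ^ d := by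
    rw [← mul_pow]; congr 1; field_simp; ring
  rw [e] at K
  exact le_of_mul_le_mul_right K (by positivity)

/-- A separated subset of maximal cardinality is a net; packing bounds the cardinalities, so a
maximum exists. -/
theorem exists_finset_net (A : Set (E d)) (x₀ : E d) {r η : ℝ} (hη : 0 < η) (hr : 0 ≤ r)
    (hA : ∀ x ∈ A, ‖x - x₀‖ ≤ r) :
    ∃ s : Finset (E d), (∀ x ∈ s, x ∈ A) ∧ (∀ x ∈ A, ∃ y ∈ s, ‖x - y‖ ≤ η) ∧
      (s.card : ℝ) ≤ (1 + 2 * r / η) ^ d := by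
  classical
  let p : Finset (E d) → Prop := fun s =>
    (∀ x ∈ s, x ∈ A) ∧ ∀ c ∈ s, ∀ c' ∈ s, c ≠ c' → η ≤ ‖c - c'‖
  have hcard : ∀ s, p s → (s.card : ℝ) ≤ (1 + 2 * r / η) ^ d := fun s hs =>
    card_le_of_separated_subset_closedBall s x₀ hη hr (fun c hc => hA c (hs.1 c hc)) hs.2
  have hbdd : BddAbove {k | ∃ s, p s ∧ s.card = k} := by
    obtain ⟨M, hM⟩ := exists_nat_ge ((1 + 2 * r / η) ^ d)
    refine ⟨M, ?_⟩
    rintro _ ⟨s, hs, rfl⟩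
    exact_mod_cast (hcard s hs).trans hM
  obtain ⟨s, hs, hsk⟩ := Nat.sSup_mem (s := {k | ∃ s, p s ∧ s.card = k})
    ⟨0, ∅, ⟨by simp, by simp⟩, rfl⟩ hbdd
  refine ⟨s, hs.1, fun x hx => ?_, hcard s hs⟩
  by_contra! hcon
  have hxs : x ∉ s := fun h => by
    have := hcon x h
    simp at this
    linarith
  have hins : p (insert x s) := by
    refine ⟨fun y hy => ?_, fun c hc c' hc' hne => ?_⟩
    · rcases Finset.mem_insert.1 hy with rfl | hy
      exacts [hx, hs.1 y hy]
    · rcases Finset.mem_insert.1 hc with h | h <;> rcases Finset.mem_insert.1 hc' with h' | h'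
      · exact absurd (h.trans h'.symm) hne
      · exact h ▸ (hcon c' h').le
      · rw [norm_sub_rev, h']; exact (hcon c h).le
      · exact hs.2 c h c' h' hne
  have := le_csSup hbdd ⟨_, hins, rfl⟩
  rw [Finset.card_insert_of_notMem hxs] at this
  omega

theorem sum_chain_le (J : ℕ) :
    ∑ j ∈ Finset.range J, (1 / 2 : ℝ) ^ j * (2 * (j + 4) + (j + 4) ^ 2 / 2) ≤ 47 := by
  have h : ∀ J : ℕ, ∑ j ∈ Finset.range J, (1 / 2 : ℝ) ^ j * (2 * (j + 4) + (j + 4) ^ 2 / 2)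
      = 47 - (1 / 2 : ℝ) ^ J * (J ^ 2 + 14 * J + 47) := fun J => by
    induction J with
    | zero => simp
    | succ J ih => rw [Finset.sum_range_succ, ih, pow_succ]; push_cast; ring
  rw [h]
  have : (0 : ℝ) ≤ (1 / 2 : ℝ) ^ J * (J ^ 2 + 14 * J + 47) := by positivity
  linarith

variable {Ω V : Type*} [MeasurableSpace Ω] [NormedAddCommGroup V]

/-- Chaining: a process indexed by a subset of a ball of radius `r` in dimension `d`, whose
increments have mixed sub-Gaussian and sub-exponential tails at scale `N`, deviates uniformly
by `O(r √(d / N))`. -/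
theorem measure_exists_increment_gt_le {μ : Measure Ω} {D : E d → Ω → V} {A : Set (E d)}
    {x₀ : E d} {N L r δ : ℝ} (hN : 0 < N) (hL : 0 < L) (hr : 0 < r) (hδ : 0 < δ)
    (hδ1 : δ ≤ 1) (hx₀ : x₀ ∈ A) (hA : ∀ x ∈ A, ‖x - x₀‖ ≤ r)
    (hU : d + 1 + log (1 / δ) ≤ N)
    (htail : ∀ x ∈ A, ∀ y ∈ A, ∀ w : ℝ, 0 ≤ w →
      μ {S | L * ‖x - y‖ * (2 * w + w ^ 2 / 2) < ‖D x S - D y S‖}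
        ≤ ENNReal.ofReal (2 * exp (-(N * w ^ 2 / 2))))
    (hlip : ∀ x ∈ A, ∀ y ∈ A, ∀ S, ‖D x S - D y S‖ ≤ 2 * L * ‖x - y‖) :
    μ {S | ∃ x ∈ A, 100 * L * r * sqrt ((d + 1 + log (1 / δ)) / N) < ‖D x S - D x₀ S‖}
      ≤ ENNReal.ofReal δ := by
  have hlog : 0 ≤ log (1 / δ) := log_nonneg (by rw [le_div_iff₀ hδ]; linarith)
  set U : ℝ := d + 1 + log (1 / δ) with hUdef
  have hU1 : 1 ≤ U := by have : (0 : ℝ) ≤ d := d.cast_nonneg; linarith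
  set v := sqrt (U / N) with hv
  have hv0 : 0 < v := sqrt_pos.2 (by positivity)
  have hv1 : v ≤ 1 := sqrt_le_one.2 ((div_le_one hN).2 hU)
  have hvsq : N * v ^ 2 = U := by rw [hv, sq_sqrt (by positivity)]; field_simp
  -- Level 0 is forced to be the base point, so that every chain starts at `x₀`.
  have hnet : ∀ j : ℕ, ∃ s : Finset (E d), (∀ x ∈ s, x ∈ A) ∧
      (∀ x ∈ A, ∃ y ∈ s, ‖x - y‖ ≤ r * (1 / 2) ^ j) ∧
      (s.card : ℝ) ≤ 2 ^ ((j + 2) * d) ∧ (j = 0 → s = {x₀}) := by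
    intro j
    rcases j.eq_zero_or_pos with rfl | hj
    · refine ⟨{x₀}, by simpa using hx₀, by simpa using hA, ?_, fun _ => rfl⟩
      simpa using one_le_pow₀ (by norm_num : (1 : ℝ) ≤ 2)
    · obtain ⟨s, h1, h2, h3⟩ := exists_finset_net A x₀ (η := r * (1 / 2) ^ j) (by positivity) hr.le hA
      refine ⟨s, h1, h2, h3.trans ?_, fun h => absurd h hj.ne'⟩
      rw [pow_mul]
      refine pow_le_pow_left₀ (by positivity) ?_ _
      have e : 2 * r / (r * (1 / 2) ^ j) = 2 * 2 ^ j := by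
        rw [one_div, inv_pow]; field_simp
      rw [e, pow_add]
      have : (1 : ℝ) ≤ 2 ^ j := one_le_pow₀ (by norm_num)
      linarith
  choose T hTA hTcov hTcard hT0 using hnet
  -- A finite chain suffices: below the scale `r v` the deterministic Lipschitz bound already costs
  -- only `2 L r v`. With the chain sum the total is `(2 · 47 + 2) L r v`.
  obtain ⟨J, hJ⟩ := exists_pow_lt_of_lt_one (y := (1 / 2 : ℝ)) hv0 (by norm_num)
  -- Thresholds growing linearly in `j` make the exponent quadratic in `j`, which beats the entropy
  -- `(2j + 5) d` of pairs of net points, while the increments remain summable against `2⁻ʲ`.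
  let w : ℕ → ℝ := fun j => (j + 4) * v
  let bad : ℕ → E d → E d → Set Ω := fun j p q =>
    {S | L * ‖p - q‖ * (2 * w j + w j ^ 2 / 2) < ‖D p S - D q S‖}
  have hsub : {S | ∃ x ∈ A, 100 * L * r * v < ‖D x S - D x₀ S‖} ⊆
      ⋃ j ∈ Finset.range J, ⋃ p ∈ T j, ⋃ q ∈ T (j + 1), bad j p q := by
    intro S hS
    by_contra hnot
    simp only [Set.mem_iUnion, not_exists, Finset.mem_range, bad, Set.mem_ofPred_eq, not_lt] at hnot
    obtain ⟨x, hx, hxS⟩ := hS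
    refine absurd hxS (not_lt.2 ?_)
    let a : ℕ → ℝ := fun j => (1 / 2 : ℝ) ^ j * (2 * (j + 4) + (j + 4) ^ 2 / 2)
    have hchain : ∀ j ≤ J, ∀ p ∈ T j, ‖x - p‖ ≤ r * (1 / 2) ^ j →
        ‖D p S - D x₀ S‖ ≤ 2 * L * r * v * ∑ i ∈ Finset.range j, a i := by
      intro j
      induction j with
      | zero =>
        intro _ p hp _
        rw [hT0 0 rfl, Finset.mem_singleton] at hp
        simp [hp]
      | succ j ih =>
        intro hj q hq hxq
        obtain ⟨p, hp, hxp⟩ := hTcov j x hx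
        have h1 := ih (by omega) p hp hxp
        have h2 := hnot j (by omega) p hp q hq
        have h3 : ‖p - q‖ ≤ 2 * r * (1 / 2) ^ j := by
          have := norm_sub_le_norm_sub_add_norm_sub p x q
          rw [norm_sub_rev p x] at this
          have h4 : r * (1 / 2 : ℝ) ^ (j + 1) ≤ r * (1 / 2) ^ j := by
            rw [pow_succ]
            have : 0 ≤ r * (1 / 2 : ℝ) ^ j := by positivity
            linarith
          linarith
        have h5 : 2 * w j + w j ^ 2 / 2 ≤ v * (2 * (j + 4) + (j + 4) ^ 2 / 2) := by
          have : v ^ 2 ≤ v := by nlinarith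
          have h6 : (0 : ℝ) ≤ (j + 4) ^ 2 := by positivity
          simp only [w]
          nlinarith
        have h7 : ‖D p S - D q S‖ ≤ 2 * L * r * v * a j := by
          refine h2.trans ?_
          calc L * ‖p - q‖ * (2 * w j + w j ^ 2 / 2)
              ≤ L * (2 * r * (1 / 2) ^ j) * (v * (2 * (j + 4) + (j + 4) ^ 2 / 2)) := by
                have : 0 ≤ w j := by positivity
                gcongr
            _ = _ := by simp only [a]; ring
        rw [Finset.sum_range_succ, mul_add]
        have := norm_sub_le_norm_sub_add_norm_sub (D q S) (D p S) (D x₀ S)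
        rw [norm_sub_rev (D q S) (D p S)] at this
        linarith
    obtain ⟨p, hp, hxp⟩ := hTcov J x hx
    have h1 := hchain J le_rfl p hp hxp
    have h2 := hlip x hx p (hTA J p hp) S
    have h3 : 2 * L * ‖x - p‖ ≤ 2 * L * (r * v) := by
      gcongr
      exact hxp.trans (mul_le_mul_of_nonneg_left hJ.le hr.le)
    have h4 : 2 * L * r * v * ∑ i ∈ Finset.range J, a i ≤ 2 * L * r * v * 47 := by
      gcongr
      exact sum_chain_le J
    have h5 := norm_sub_le_norm_sub_add_norm_sub (D x S) (D p S) (D x₀ S)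
    have h6 : 0 < L * r * v := by positivity
    nlinarith
  refine (measure_mono hsub).trans ?_
  -- Union bound over all pairs of consecutive net points; level `j` receives the share `δ
  -- 2^{-(j+1)}`.
  have hlev : ∀ j : ℕ, (((T j).card : ℝ) * (T (j + 1)).card) * (2 * exp (-(N * w j ^ 2 / 2)))
      ≤ δ * (1 / 2) ^ (j + 1) := by
    intro j
    have h1 : ((T j).card : ℝ) * (T (j + 1)).card ≤ 2 ^ ((2 * j + 5) * d) := by
      calc _ ≤ (2 : ℝ) ^ ((j + 2) * d) * 2 ^ ((j + 1 + 2) * d) := by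
            gcongr
            exacts [hTcard j, hTcard (j + 1)]
        _ = _ := by rw [← pow_add]; congr 1; ring
    have h2 : (2 : ℝ) ^ ((2 * j + 5) * d) * 2 * 2 ^ (j + 1)
        ≤ exp ((2 * j + 5) * d + (j + 2)) := by
      have he : (2 : ℝ) ≤ exp 1 := by linarith [add_one_le_exp (1 : ℝ)]
      calc (2 : ℝ) ^ ((2 * j + 5) * d) * 2 * 2 ^ (j + 1) = 2 ^ ((2 * j + 5) * d + (j + 2)) := by ring
        _ ≤ exp 1 ^ ((2 * j + 5) * d + (j + 2)) := by gcongr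
        _ = _ := by rw [← exp_nat_mul]; push_cast; ring_nf
    have h3 : exp (-(N * w j ^ 2 / 2)) * exp ((2 * j + 5) * d + (j + 2)) ≤ δ := by
      rw [← exp_add]
      have e : δ = exp (-log (1 / δ)) := by
        rw [one_div, log_inv, neg_neg, exp_log hδ]
      rw [e]
      apply exp_le_exp.2
      have e2 : N * w j ^ 2 = (j + 4) ^ 2 * U := by rw [← hvsq]; simp only [w]; ring
      rw [e2, hUdef]
      have hd : (0 : ℝ) ≤ d := d.cast_nonneg
      have hj : (0 : ℝ) ≤ j := j.cast_nonneg
      nlinarith [mul_nonneg hj hd, mul_nonneg hj hlog, mul_nonneg (mul_nonneg hj hj) hd,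
        mul_nonneg (mul_nonneg hj hj) hlog]
    have h4 : (1 / 2 : ℝ) ^ (j + 1) * 2 ^ (j + 1) = 1 := by rw [← mul_pow]; norm_num
    calc ((T j).card : ℝ) * (T (j + 1)).card * (2 * exp (-(N * w j ^ 2 / 2)))
        ≤ 2 ^ ((2 * j + 5) * d) * (2 * exp (-(N * w j ^ 2 / 2))) := by gcongr
      _ = exp (-(N * w j ^ 2 / 2)) * (2 ^ ((2 * j + 5) * d) * 2 * 2 ^ (j + 1))
            * (1 / 2 : ℝ) ^ (j + 1) := by
          linear_combination (-(2 : ℝ) ^ ((2 * j + 5) * d) * (2 * exp (-(N * w j ^ 2 / 2)))) * h4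
      _ ≤ exp (-(N * w j ^ 2 / 2)) * exp ((2 * j + 5) * d + (j + 2)) * (1 / 2 : ℝ) ^ (j + 1) := by
          gcongr
      _ ≤ _ := by gcongr
  calc μ (⋃ j ∈ Finset.range J, ⋃ p ∈ T j, ⋃ q ∈ T (j + 1), bad j p q)
      ≤ ∑ j ∈ Finset.range J, ∑ p ∈ T j, ∑ q ∈ T (j + 1), μ (bad j p q) := by
        refine (measure_biUnion_finset_le _ _).trans (Finset.sum_le_sum fun j _ => ?_)
        refine (measure_biUnion_finset_le _ _).trans (Finset.sum_le_sum fun p _ => ?_)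
        exact measure_biUnion_finset_le _ _
    _ ≤ ∑ j ∈ Finset.range J, ∑ p ∈ T j, ∑ q ∈ T (j + 1),
          ENNReal.ofReal (2 * exp (-(N * w j ^ 2 / 2))) := by
        refine Finset.sum_le_sum fun j _ => Finset.sum_le_sum fun p hp => Finset.sum_le_sum
          fun q hq => htail p (hTA j p hp) q (hTA _ q hq) (w j) (by positivity)
    _ = ∑ j ∈ Finset.range J, ENNReal.ofReal
          (((T j).card * (T (j + 1)).card) * (2 * exp (-(N * w j ^ 2 / 2)))) := by
        refine Finset.sum_congr rfl fun j _ => ?_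
        rw [Finset.sum_const, Finset.sum_const, nsmul_eq_mul, nsmul_eq_mul, mul_assoc,
          ENNReal.ofReal_mul (Nat.cast_nonneg _), ENNReal.ofReal_mul (Nat.cast_nonneg _),
          ENNReal.ofReal_natCast, ENNReal.ofReal_natCast]
    _ ≤ ∑ j ∈ Finset.range J, ENNReal.ofReal (δ * (1 / 2) ^ (j + 1)) :=
        Finset.sum_le_sum fun j _ => ENNReal.ofReal_le_ofReal (hlev j)
    _ = ENNReal.ofReal (∑ j ∈ Finset.range J, δ * (1 / 2) ^ (j + 1)) :=
        (ENNReal.ofReal_sum_of_nonneg fun j _ => by positivity).symm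
    _ ≤ ENNReal.ofReal δ := by
        refine ENNReal.ofReal_le_ofReal ?_
        rw [← Finset.mul_sum]
        refine mul_le_of_le_one_right hδ.le ?_
        have h : ∀ J : ℕ, ∑ j ∈ Finset.range J, (1 / 2 : ℝ) ^ (j + 1) = 1 - (1 / 2) ^ J := fun J => by
          induction J with
          | zero => simp
          | succ J ih => rw [Finset.sum_range_succ, ih]; ring
        rw [h]
        have : (0 : ℝ) < (1 / 2) ^ J := by positivity
        linarith

/-- Localized uniform deviation, by peeling over dyadic shells around `xs`. -/
theorem measure_exists_localized_increment_gt_le {μ : Measure Ω} {D : E d → Ω → V} {X : Set (E d)}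
    {xs : E d} {N L R δ : ℝ} {M : ℕ} (hN : 0 < N) (hL : 0 < L) (hδ : 0 < δ)
    (hδ1 : δ ≤ 1) (hM : R * N ≤ 2 ^ M) (hxs : xs ∈ X) (hR : ∀ x ∈ X, ‖x - xs‖ ≤ R)
    (hU : d + 1 + log ((M + 1) / δ) ≤ N)
    (htail : ∀ x ∈ X, ∀ y ∈ X, ∀ w : ℝ, 0 ≤ w →
      μ {S | L * ‖x - y‖ * (2 * w + w ^ 2 / 2) < ‖D x S - D y S‖}
        ≤ ENNReal.ofReal (2 * exp (-(N * w ^ 2 / 2))))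
    (hlip : ∀ x ∈ X, ∀ y ∈ X, ∀ S, ‖D x S - D y S‖ ≤ 2 * L * ‖x - y‖) :
    μ {S | ∃ x ∈ X, 200 * L * max ‖x - xs‖ (1 / N) * sqrt ((d + 1 + log ((M + 1) / δ)) / N)
        < ‖D x S - D xs S‖} ≤ ENNReal.ofReal δ := by
  set v := sqrt ((d + 1 + log ((M + 1) / δ)) / N) with hv
  have hv0 : 0 ≤ v := sqrt_nonneg _
  let A : ℕ → Set (E d) := fun k => X ∩ {x | ‖x - xs‖ ≤ 2 ^ k / N}
  have hsub : {S | ∃ x ∈ X, 200 * L * max ‖x - xs‖ (1 / N) * v < ‖D x S - D xs S‖} ⊆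
      ⋃ k ∈ Finset.range (M + 1), {S | ∃ x ∈ A k, 100 * L * (2 ^ k / N) * v < ‖D x S - D xs S‖} := by
    rintro S ⟨x, hx, hlt⟩
    have hex : ∃ k : ℕ, ‖x - xs‖ ≤ 2 ^ k / N := ⟨M, (hR x hx).trans ((le_div_iff₀ hN).2 hM)⟩
    classical
    have hk := Nat.find_spec hex
    have hkM : Nat.find hex ≤ M := Nat.find_min' hex ((hR x hx).trans ((le_div_iff₀ hN).2 hM))
    set k := Nat.find hex with hkdef
    simp only [Set.mem_iUnion, Finset.mem_range]
    refine ⟨k, by omega, x, ⟨hx, hk⟩, lt_of_le_of_lt ?_ hlt⟩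
    -- The smallest shell containing `x` has radius at most twice `‖x - xs‖`, except for the
    -- innermost shell, of radius `1/N`. The lost factor 2 turns 100 into 200.
    have h1 : 2 ^ k / N ≤ 2 * max ‖x - xs‖ (1 / N) := by
      rcases Nat.eq_zero_or_pos k with h0 | hpos
      · rw [h0, pow_zero]
        have : 0 ≤ 1 / N := by positivity
        linarith [le_max_right ‖x - xs‖ (1 / N)]
      · have h2 := Nat.find_min hex (m := k - 1) (by omega)
        have h3 : (2 : ℝ) ^ k / N = 2 * (2 ^ (k - 1) / N) := by
          conv_lhs => rw [← Nat.sub_add_cancel hpos, pow_succ]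
          ring
        rw [h3]
        linarith [le_max_left ‖x - xs‖ (1 / N)]
    calc 100 * L * (2 ^ k / N) * v ≤ 100 * L * (2 * max ‖x - xs‖ (1 / N)) * v := by gcongr
      _ = _ := by ring
  refine (measure_mono hsub).trans ((measure_biUnion_finset_le _ _).trans ?_)
  have hM0 : (0 : ℝ) < M + 1 := by positivity
  have e : (1 : ℝ) / (δ / (M + 1)) = (M + 1) / δ := by field_simp
  have hk : ∀ k ∈ Finset.range (M + 1),
      μ {S | ∃ x ∈ A k, 100 * L * (2 ^ k / N) * v < ‖D x S - D xs S‖}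
        ≤ ENNReal.ofReal (δ / (M + 1)) := by
    intro k _
    have := measure_exists_increment_gt_le (μ := μ) (D := D) (A := A k) (x₀ := xs) (N := N)
      (L := L) (r := 2 ^ k / N) (δ := δ / (M + 1)) hN hL (by positivity) (by positivity)
      ((div_le_self hδ.le (by linarith [(M.cast_nonneg : (0 : ℝ) ≤ M)])).trans hδ1)
      ⟨hxs, by simp; positivity⟩ (fun x hx => hx.2) (by rw [e]; exact hU)
      (fun x hx y hy => htail x hx.1 y hy.1) (fun x hx y hy => hlip x hx.1 y hy.1)
    rw [e] at this
    exact this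
  refine (Finset.sum_le_sum hk).trans (le_of_eq ?_)
  rw [Finset.sum_const, Finset.card_range, nsmul_eq_mul, ← ENNReal.ofReal_natCast,
    ← ENNReal.ofReal_mul (Nat.cast_nonneg _)]
  congr 1
  push_cast
  field_simp

end Chaining

/-! ### Deviations of empirical means. -/

section Deviation

variable {d : ℕ} {Z V : Type*} [MeasurableSpace Z] [NormedAddCommGroup V] [InnerProductSpace ℝ V]

/-- The deviation of the empirical mean of `g` over the sample `S` from its expectation. -/
def dev {n : ℕ} (P : Measure Z) (g : Z → V) (S : Fin n → Z) : V :=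
  (1 / (n : ℝ)) • ∑ i, g (S i) - ∫ z, g z ∂P

theorem smul_dev {n : ℕ} (hn : n ≠ 0) (P : Measure Z) (g : Z → V) (S : Fin n → Z) :
    (n : ℝ) • dev P g S = ∑ i, (g (S i) - ∫ z, g z ∂P) := by
  have : (n : ℝ) ≠ 0 := Nat.cast_ne_zero.2 hn
  rw [dev, smul_sub, smul_smul, mul_one_div_cancel this, one_smul, Finset.sum_sub_distrib,
    Finset.sum_const, Finset.card_univ, Fintype.card_fin, Nat.cast_smul_eq_nsmul]

theorem norm_sum_eq_norm_dev {n : ℕ} (hn : n ≠ 0) (P : Measure Z) (g : Z → V) (S : Fin n → Z) :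
    ‖∑ i, (g (S i) - ∫ z, g z ∂P)‖ = n * ‖dev P g S‖ := by
  rw [← smul_dev hn, norm_smul, Real.norm_natCast]

theorem dev_sub_dev {n : ℕ} {P : Measure Z} {g g' : Z → V} (hg : Integrable g P)
    (hg' : Integrable g' P) (S : Fin n → Z) :
    dev P g S - dev P g' S = dev P (fun z => g z - g' z) S := by
  simp only [dev]
  rw [integral_sub hg hg', Finset.sum_sub_distrib, smul_sub]
  abel

theorem norm_dev_le {n : ℕ} (hn : n ≠ 0) {P : Measure Z} [IsProbabilityMeasure P] {g : Z → V}
    {b : ℝ} (hb : ∀ z, ‖g z‖ ≤ b) (S : Fin n → Z) : ‖dev P g S‖ ≤ 2 * b := by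
  have h1 : ‖(1 / (n : ℝ)) • ∑ i, g (S i)‖ ≤ b := by
    have hn0 : (0 : ℝ) < n := Nat.cast_pos.2 (Nat.pos_of_ne_zero hn)
    rw [norm_smul, Real.norm_of_nonneg (by positivity), one_div_mul_eq_div, div_le_iff₀ hn0]
    refine (norm_sum_le _ _).trans ((Finset.sum_le_sum fun i _ => hb (S i)).trans (le_of_eq ?_))
    simp [mul_comm]
  have h2 : ‖∫ z, g z ∂P‖ ≤ b := by
    simpa using norm_integral_le_of_norm_le_const (μ := P) (Filter.Eventually.of_forall hb)
  exact (norm_sub_le _ _).trans (by linarith)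

theorem measure_norm_dev_gt_le [CompleteSpace V] {P : Measure Z} [IsProbabilityMeasure P]
    {g : Z → V} (hg : AEStronglyMeasurable g P) {σ B w κ : ℝ} (hσ : 0 ≤ σ) (hB : 0 ≤ B)
    (hw : 0 ≤ w) (hκ : Real.exp (w * σ / (σ + B * w)) ≤ κ)
    (hmom : ∀ k : ℕ, 2 ≤ k → Integrable (fun z => ‖g z‖ ^ k) P ∧
      ∫ z, ‖g z‖ ^ k ∂P ≤ (k.factorial : ℝ) / 2 * σ ^ 2 * B ^ (k - 2)) {n : ℕ} (hn : n ≠ 0) :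
    Measure.pi (fun _ : Fin n => P)
        {S | (1 + κ) / 2 * σ * w + B * w ^ 2 / 2 < ‖dev P g S‖}
      ≤ ENNReal.ofReal (2 * Real.exp (-(n * w ^ 2 / 2))) := by
  have hn0 : (0 : ℝ) < n := Nat.cast_pos.2 (Nat.pos_of_ne_zero hn)
  have := measure_norm_sum_gt_le hg hσ hB hw hκ hmom n
  simp_rw [norm_sum_eq_norm_dev hn, mul_lt_mul_iff_right₀ hn0] at this
  exact this

/-- Uniform localized deviation of a random Lipschitz field. -/
theorem measure_exists_dev_gt_le [CompleteSpace V] {P : Measure Z} [IsProbabilityMeasure P]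
    {X : Set (E d)} {xs : E d} {h : E d → Z → V} {L R δ : ℝ} {M n : ℕ} (hn : n ≠ 0) (hL : 0 < L)
    (hint : ∀ x ∈ X, Integrable (h x) P)
    (hlip : ∀ x ∈ X, ∀ y ∈ X, ∀ z, ‖h x z - h y z‖ ≤ L * ‖x - y‖)
    (hδ : 0 < δ) (hδ1 : δ ≤ 1) (hM : R * n ≤ 2 ^ M) (hxs : xs ∈ X) (hR : ∀ x ∈ X, ‖x - xs‖ ≤ R)
    (hU : d + 1 + Real.log ((M + 1) / δ) ≤ n) :
    Measure.pi (fun _ : Fin n => P) {S | ∃ x ∈ X,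
      200 * L * max ‖x - xs‖ (1 / n) * Real.sqrt ((d + 1 + Real.log ((M + 1) / δ)) / n)
        < ‖dev P (h x) S - dev P (h xs) S‖} ≤ ENNReal.ofReal δ := by
  have hn0 : (0 : ℝ) < n := Nat.cast_pos.2 (Nat.pos_of_ne_zero hn)
  refine measure_exists_localized_increment_gt_le (D := fun x S => dev P (h x) S) hn0 hL hδ hδ1 hM
    hxs hR hU (fun x hx y hy w hw => ?_) (fun x hx y hy S => ?_)
  · simp_rw [dev_sub_dev (hint x hx) (hint y hy)]
    have hm := ((hint x hx).sub (hint y hy)).aestronglyMeasurable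
    set b := L * ‖x - y‖ with hb
    have hb0 : 0 ≤ b := by positivity
    -- A vector bounded by `b` satisfies Bernstein's condition with `σ = B = b`, since `k!/2 ≥ 1`.
    -- Then `κ = 3` gives exactly the increment threshold `b (2w + w²/2)` required by chaining.
    have hκ : Real.exp (w * b / (b + b * w)) ≤ 3 := by
      have : w * b / (b + b * w) ≤ 1 := div_le_one_of_le₀ (by nlinarith) (by positivity)
      exact (Real.exp_le_exp.2 this).trans Real.exp_one_lt_three.le
    have hbd : ∀ (k : ℕ) z, ‖h x z - h y z‖ ^ k ≤ b ^ k := fun k z =>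
      pow_le_pow_left₀ (norm_nonneg _) (hlip x hx y hy z) k
    have := measure_norm_dev_gt_le (g := fun z => h x z - h y z) hm hb0 hb0 hw hκ (fun k hk => by
      have hi : Integrable (fun z => ‖h x z - h y z‖ ^ k) P := by
        refine Integrable.mono' (integrable_const (b ^ k)) (hm.norm.pow k)
          (Filter.Eventually.of_forall fun z => ?_)
        rw [Real.norm_of_nonneg (by positivity)]
        exact hbd k z
      refine ⟨hi, ?_⟩
      have h1 : ∫ z, ‖h x z - h y z‖ ^ k ∂P ≤ b ^ k := by
        have := integral_mono hi (integrable_const (b ^ k)) (hbd k)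
        simpa using this
      refine h1.trans ?_
      obtain ⟨j, rfl⟩ := Nat.exists_eq_add_of_le hk
      rw [Nat.add_sub_cancel_left, mul_assoc, ← pow_add]
      refine le_mul_of_one_le_left (by positivity) ?_
      have : (2 : ℝ) ≤ (2 + j).factorial := by
        exact_mod_cast (Nat.self_le_factorial 2).trans (Nat.factorial_le (by omega))
      linarith) hn
    refine le_trans (measure_mono fun S hS => ?_) this
    simp only [Set.mem_ofPred_eq] at hS ⊢
    refine lt_of_eq_of_lt ?_ hS
    ring
  · rw [dev_sub_dev (hint x hx) (hint y hy), mul_assoc]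
    exact norm_dev_le hn (fun z => hlip x hx y hy z) S

end Deviation

/-! ### First-order calculus on convex sets, with differentiability expressed by quadratic
remainders. -/

section FirstOrder

variable {k : ℕ} {s : Set (E k)} {φ : E k → ℝ} {x : E k}

theorem hasFDerivWithinAt_of_quadratic {g : E k} {C : ℝ}
    (h : ∀ x' ∈ s, |φ x' - φ x - inner ℝ g (x' - x)| ≤ C * ‖x' - x‖ ^ 2) :
    HasFDerivWithinAt φ (innerSL ℝ g) s x := by
  rw [hasFDerivWithinAt_iff_isLittleO]
  have h1 : (fun x' => φ x' - φ x - innerSL ℝ g (x' - x)) =O[nhdsWithin x s]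
      fun x' => ‖x' - x‖ ^ 2 := by
    refine Asymptotics.IsBigO.of_bound C ?_
    filter_upwards [self_mem_nhdsWithin] with x' hx'
    simpa using h x' hx'
  refine h1.trans_isLittleO ?_
  have h2 : (fun x' => ‖x' - x‖ ^ 2) =o[nhds x] fun x' => x' - x := by
    exact (Asymptotics.isLittleO_norm_pow_id (E' := E k) one_lt_two).comp_tendsto
      (tendsto_sub_nhds_zero_iff.2 Filter.tendsto_id : Filter.Tendsto (fun x' => x' - x) (nhds x) _)
  exact h2.mono nhdsWithin_le_nhds

theorem gradientWithin_eq_of_quadratic {g : E k} {C : ℝ} (hs : Convex ℝ s)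
    (hi : (interior s).Nonempty) (hx : x ∈ s)
    (h : ∀ x' ∈ s, |φ x' - φ x - inner ℝ g (x' - x)| ≤ C * ‖x' - x‖ ^ 2) :
    gradientWithin φ s x = g := by
  have hd := hasFDerivWithinAt_of_quadratic h
  rw [gradientWithin, hd.fderivWithin (uniqueDiffOn_convex hs hi x hx)]
  exact (InnerProductSpace.toDual ℝ (E k)).symm_apply_apply g

theorem quadratic_of_lipschitz_gradient (hs : Convex ℝ s) (hd : DifferentiableOn ℝ φ s) {β : ℝ}
    (hlip : ∀ a ∈ s, ∀ b ∈ s, ‖gradientWithin φ s a - gradientWithin φ s b‖ ≤ β * ‖a - b‖)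
    (hx : x ∈ s) {x' : E k} (hx' : x' ∈ s) :
    |φ x' - φ x - inner ℝ (gradientWithin φ s x) (x' - x)| ≤ β / 2 * ‖x' - x‖ ^ 2 := by
  set v := x' - x with hv
  set g := gradientWithin φ s with hg
  have hmem : ∀ t ∈ Set.Icc (0 : ℝ) 1, x + t • v ∈ s := fun t ht => by
    have := hs.add_smul_sub_mem hx hx' ht
    exact this
  have hline : ∀ t, HasDerivAt (fun t : ℝ => x + t • v) v t := fun t => by
    simpa using ((hasDerivAt_id t).smul_const v).const_add x
  have hder : ∀ t ∈ Set.Icc (0 : ℝ) 1,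
      HasDerivWithinAt (fun t : ℝ => φ (x + t • v) - φ x - t * inner ℝ (g x) v)
        (inner ℝ (g (x + t • v)) v - inner ℝ (g x) v) (Set.Icc 0 1) t := by
    intro t ht
    have h1 := (hd _ (hmem t ht)).hasFDerivWithinAt
    have h2 := h1.comp_hasDerivWithinAt t (hline t).hasDerivWithinAt (fun r hr => hmem r hr)
    have h3 : (fderivWithin ℝ φ s (x + t • v)) v = inner ℝ (g (x + t • v)) v := by
      rw [hg, gradientWithin, InnerProductSpace.toDual_symm_apply]
    rw [h3] at h2
    have h4 : HasDerivWithinAt (fun t : ℝ => t * inner ℝ (g x) v) (inner ℝ (g x) v)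
        (Set.Icc 0 1) t := by
      simpa using (hasDerivWithinAt_id t _).mul_const (inner ℝ (g x) v)
    exact (h2.sub_const _).sub h4
  have hB : ∀ t : ℝ, HasDerivAt (fun t : ℝ => β / 2 * ‖v‖ ^ 2 * t ^ 2) (β * ‖v‖ ^ 2 * t) t :=
    fun t => by
      refine ((hasDerivAt_pow 2 t).const_mul (β / 2 * ‖v‖ ^ 2)).congr_deriv ?_
      rw [Nat.add_one_sub_one]
      push_cast
      ring
  have := image_norm_le_of_norm_deriv_right_le_deriv_boundary
    (f := fun t : ℝ => φ (x + t • v) - φ x - t * inner ℝ (g x) v)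
    (f' := fun t => inner ℝ (g (x + t • v)) v - inner ℝ (g x) v)
    (B := fun t : ℝ => β / 2 * ‖v‖ ^ 2 * t ^ 2) (B' := fun t => β * ‖v‖ ^ 2 * t) (a := 0) (b := 1)
    (fun t ht => (hder t ht).continuousWithinAt)
    (fun t ht => (hder t ⟨ht.1, ht.2.le⟩).mono_of_mem_nhdsWithin (Icc_mem_nhdsGE_of_mem ht))
    (by simp) hB
    (fun t ht => by
      rw [← inner_sub_left]
      refine (norm_inner_le_norm _ _).trans ?_
      have := hlip _ (hmem t ⟨ht.1, ht.2.le⟩) x hx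
      rw [add_sub_cancel_left, norm_smul, Real.norm_of_nonneg ht.1] at this
      calc _ ≤ β * (t * ‖v‖) * ‖v‖ := by gcongr
        _ = _ := by ring)
    (Set.right_mem_Icc.2 zero_le_one)
  simpa [hv] using this

/-- Used to pass to the limit in variational inequalities: move by `t` along a segment, divide by
`t`, let `t → 0`. -/
theorem le_zero_of_forall_le_mul {A C : ℝ} (h : ∀ t : ℝ, 0 < t → t < 1 → A ≤ t * C) : A ≤ 0 := by
  have h1 : Filter.Tendsto (fun t : ℝ => t * C) (nhdsWithin 0 (Set.Ioi 0)) (nhds 0) := by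
    have : Filter.Tendsto (fun t : ℝ => t * C) (nhds 0) (nhds (0 * C)) :=
      Filter.tendsto_id.mul_const C
    rw [zero_mul] at this
    exact this.mono_left nhdsWithin_le_nhds
  refine ge_of_tendsto h1 ?_
  filter_upwards [Ioo_mem_nhdsGT (zero_lt_one' ℝ)] with t ht using h t ht.1 ht.2

theorem strongConcave_first_order {g : E k} {C μ : ℝ} (hc : StrongConcaveOn s μ φ) (hx : x ∈ s)
    (h : ∀ x' ∈ s, |φ x' - φ x - inner ℝ g (x' - x)| ≤ C * ‖x' - x‖ ^ 2) {x' : E k}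
    (hx' : x' ∈ s) : φ x' ≤ φ x + inner ℝ g (x' - x) - μ / 2 * ‖x' - x‖ ^ 2 := by
  suffices hs : φ x' - φ x - inner ℝ g (x' - x) + μ / 2 * ‖x' - x‖ ^ 2 ≤ 0 by linarith
  refine le_zero_of_forall_le_mul (C := (C + μ / 2) * ‖x' - x‖ ^ 2) fun t ht0 ht1 => ?_
  have h1 := hc.2 hx hx' (by linarith : (0 : ℝ) ≤ 1 - t) ht0.le (by ring)
  have hm : (1 - t) • x + t • x' ∈ s := hc.1 hx hx' (by linarith) ht0.le (by ring)
  have h2 := (abs_le.1 (h _ hm)).2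
  rw [show (1 - t) • x + t • x' - x = t • (x' - x) by module, inner_smul_right, norm_smul,
    Real.norm_of_nonneg ht0.le] at h2
  simp only [smul_eq_mul] at h1
  rw [norm_sub_rev] at h1
  have h3 : t * (φ x' - φ x - inner ℝ g (x' - x) + μ / 2 * ‖x' - x‖ ^ 2)
      ≤ t * (t * ((C + μ / 2) * ‖x' - x‖ ^ 2)) := by linarith
  exact le_of_mul_le_mul_left h3 ht0

/-- Measurability of `g` is not assumed. Its inner products with feasible directions are limits of
difference quotients, dominated through the quadratic expansion; interior points make these
directions span the space. -/
theorem integrable_gradient {Z : Type*} [MeasurableSpace Z] {P : Measure Z}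
    [IsProbabilityMeasure P] {φ : E k → Z → ℝ} {g : Z → E k} {C : ℝ} (hs : Convex ℝ s)
    (hi : (interior s).Nonempty) (hx : x ∈ s) (hint : ∀ x' ∈ s, Integrable (φ x') P)
    (h : ∀ x' ∈ s, ∀ z, |φ x' z - φ x z - inner ℝ (g z) (x' - x)| ≤ C * ‖x' - x‖ ^ 2) :
    Integrable g P := by
  have h1 : ∀ x' ∈ s, Integrable (fun z => inner ℝ (g z) (x' - x)) P := by
    intro x' hx'
    have hm : AEStronglyMeasurable (fun z => inner ℝ (g z) (x' - x)) P := by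
      refine aestronglyMeasurable_of_tendsto_ae Filter.atTop
        (f := fun (n : ℕ) z => ((n : ℝ) + 1) * (φ (x + (1 / ((n : ℝ) + 1)) • (x' - x)) z - φ x z))
        (fun n => ?_) (Filter.Eventually.of_forall fun z => ?_)
      · have hmem : x + (1 / ((n : ℝ) + 1)) • (x' - x) ∈ s := by
          refine hs.add_smul_sub_mem hx hx' ⟨by positivity, ?_⟩
          exact div_le_one_of_le₀ (by linarith [(n.cast_nonneg : (0 : ℝ) ≤ n)]) (by positivity)
        exact (((hint _ hmem).sub (hint x hx)).const_mul _).aestronglyMeasurable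
      · rw [tendsto_iff_norm_sub_tendsto_zero]
        have hlim : Filter.Tendsto (fun n : ℕ => C * ‖x' - x‖ ^ 2 * (1 / ((n : ℝ) + 1)))
            Filter.atTop (nhds 0) := by
          simpa using tendsto_one_div_add_atTop_nhds_zero_nat.const_mul (C * ‖x' - x‖ ^ 2)
        refine squeeze_zero (fun _ => norm_nonneg _) (fun n => ?_) hlim
        have hmem : x + (1 / ((n : ℝ) + 1)) • (x' - x) ∈ s := by
          refine hs.add_smul_sub_mem hx hx' ⟨by positivity, ?_⟩
          exact div_le_one_of_le₀ (by linarith [(n.cast_nonneg : (0 : ℝ) ≤ n)]) (by positivity)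
        have h2 := h _ hmem z
        have hn : (0 : ℝ) < (n : ℝ) + 1 := by positivity
        rw [add_sub_cancel_left, inner_smul_right, norm_smul,
          Real.norm_of_nonneg (by positivity : (0 : ℝ) ≤ 1 / ((n : ℝ) + 1))] at h2
        set q := φ (x + (1 / ((n : ℝ) + 1)) • (x' - x)) z - φ x z
        have e : ((n : ℝ) + 1) * q - inner ℝ (g z) (x' - x)
            = ((n : ℝ) + 1) * (q - 1 / ((n : ℝ) + 1) * inner ℝ (g z) (x' - x)) := by
          field_simp
        rw [e, norm_mul, Real.norm_of_nonneg hn.le, Real.norm_eq_abs]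
        calc _ ≤ ((n : ℝ) + 1) * (C * (1 / ((n : ℝ) + 1) * ‖x' - x‖) ^ 2) := by gcongr
          _ = _ := by field_simp
    refine Integrable.mono' (g := fun z => |φ x' z - φ x z| + C * ‖x' - x‖ ^ 2)
      (((hint x' hx').sub (hint x hx)).abs.add (integrable_const _)) hm
      (Filter.Eventually.of_forall fun z => ?_)
    have h2 := h x' hx' z
    have h3 := abs_sub_abs_le_abs_sub (inner ℝ (g z) (x' - x)) (φ x' z - φ x z)
    rw [abs_sub_comm (inner ℝ (g z) (x' - x)) (φ x' z - φ x z)] at h3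
    rw [Real.norm_eq_abs]
    linarith
  have h2 : ∀ v : E k, Integrable (fun z => inner ℝ (g z) v) P := by
    intro v
    obtain ⟨x₀, hx₀⟩ := hi
    rw [mem_interior_iff_mem_nhds, Metric.mem_nhds_iff] at hx₀
    obtain ⟨ε, hε, hball⟩ := hx₀
    set c := ε / (2 * (‖v‖ + 1)) with hc
    have hc0 : 0 < c := by positivity
    have hv : x₀ + c • v ∈ s := by
      apply hball
      rw [mem_ball_iff_norm, add_sub_cancel_left, norm_smul, Real.norm_of_nonneg hc0.le, hc,
        div_mul_eq_mul_div, div_lt_iff₀ (by positivity)]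
      nlinarith [norm_nonneg v]
    have h3 := (h1 _ hv).sub (h1 x₀ (hball (Metric.mem_ball_self hε)))
    have h4 := h3.const_mul c⁻¹
    refine h4.congr (Filter.Eventually.of_forall fun z => ?_)
    simp only [Pi.sub_apply]
    rw [← inner_sub_right, show x₀ + c • v - x - (x₀ - x) = c • v by abel, inner_smul_right,
      inv_mul_cancel_left₀ hc0.ne']
  have h3 : ∀ z, g z = ∑ i, inner ℝ (g z) (EuclideanSpace.basisFun (Fin k) ℝ i) •
      EuclideanSpace.basisFun (Fin k) ℝ i := fun z => by
    conv_lhs => rw [← (EuclideanSpace.basisFun (Fin k) ℝ).sum_repr' (g z)]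
    exact Finset.sum_congr rfl fun i _ => by rw [real_inner_comm]
  rw [show g = fun z => ∑ i, inner ℝ (g z) (EuclideanSpace.basisFun (Fin k) ℝ i) •
      EuclideanSpace.basisFun (Fin k) ℝ i from funext h3]
  exact integrable_finsetSum _ fun i _ => (h2 _).smul_const _

end FirstOrder

/-! ### Deterministic analysis of smooth, strongly concave minimax problems. -/

section Deterministic

variable {d d' : ℕ}

/-- `G` is smooth and strongly concave in `y` on `X × Y`, with partial gradients `gx`, `gy`. -/
structure SCSmooth (X : Set (E d)) (Y : Set (E d')) (β μ : ℝ) (G : E d → E d' → ℝ)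
    (gx : E d → E d' → E d) (gy : E d → E d' → E d') : Prop where
  expand_x : ∀ y ∈ Y, ∀ x ∈ X, ∀ x' ∈ X,
    |G x' y - G x y - inner ℝ (gx x y) (x' - x)| ≤ β / 2 * ‖x' - x‖ ^ 2
  expand_y : ∀ x ∈ X, ∀ y ∈ Y, ∀ y' ∈ Y,
    |G x y' - G x y - inner ℝ (gy x y) (y' - y)| ≤ β / 2 * ‖y' - y‖ ^ 2
  concave_y : ∀ x ∈ X, ∀ y ∈ Y, ∀ y' ∈ Y,
    G x y' ≤ G x y + inner ℝ (gy x y) (y' - y) - μ / 2 * ‖y' - y‖ ^ 2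
  lip_x : ∀ x ∈ X, ∀ x' ∈ X, ∀ y ∈ Y, ∀ y' ∈ Y,
    ‖gx x y - gx x' y'‖ ≤ β * (‖x - x'‖ + ‖y - y'‖)
  lip_y : ∀ x ∈ X, ∀ x' ∈ X, ∀ y ∈ Y, ∀ y' ∈ Y,
    ‖gy x y - gy x' y'‖ ≤ β * (‖x - x'‖ + ‖y - y'‖)

namespace SCSmooth

variable {X : Set (E d)} {Y : Set (E d')} {β μ : ℝ} {G : E d → E d' → ℝ}
  {gx : E d → E d' → E d} {gy : E d → E d' → E d'}

/-- Every clause is stable under averaging. Taking `P` or the uniform measure on the sample handles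
the population and empirical risks at once. -/
theorem integral {Z : Type*} [MeasurableSpace Z] {P : Measure Z} [IsProbabilityMeasure P]
    {f : E d → E d' → Z → ℝ} {gx : E d → E d' → Z → E d} {gy : E d → E d' → Z → E d'}
    (h : ∀ z, SCSmooth X Y β μ (fun x y => f x y z) (fun x y => gx x y z) (fun x y => gy x y z))
    (hf : ∀ x ∈ X, ∀ y ∈ Y, Integrable (f x y) P)
    (hgx : ∀ x ∈ X, ∀ y ∈ Y, Integrable (gx x y) P)
    (hgy : ∀ x ∈ X, ∀ y ∈ Y, Integrable (gy x y) P) :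
    SCSmooth X Y β μ (fun x y => ∫ z, f x y z ∂P) (fun x y => ∫ z, gx x y z ∂P)
      (fun x y => ∫ z, gy x y z ∂P) where
  expand_x y hy x hx x' hx' := by
    have h1 : Integrable (fun z => f x' y z - f x y z) P := (hf x' hx' y hy).sub (hf x hx y hy)
    rw [real_inner_comm, ← integral_inner (hgx x hx y hy), ← integral_sub (hf x' hx' y hy) (hf x hx y hy),
      ← integral_sub h1 ((hgx x hx y hy).const_inner _), ← Real.norm_eq_abs]
    refine (norm_integral_le_of_norm_le_const (C := β / 2 * ‖x' - x‖ ^ 2)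
      (Filter.Eventually.of_forall fun z => ?_)).trans (by simp)
    rw [real_inner_comm]
    exact (h z).expand_x y hy x hx x' hx'
  expand_y x hx y hy y' hy' := by
    have h1 : Integrable (fun z => f x y' z - f x y z) P := (hf x hx y' hy').sub (hf x hx y hy)
    rw [real_inner_comm, ← integral_inner (hgy x hx y hy), ← integral_sub (hf x hx y' hy') (hf x hx y hy),
      ← integral_sub h1 ((hgy x hx y hy).const_inner _), ← Real.norm_eq_abs]
    refine (norm_integral_le_of_norm_le_const (C := β / 2 * ‖y' - y‖ ^ 2)
      (Filter.Eventually.of_forall fun z => ?_)).trans (by simp)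
    rw [real_inner_comm]
    exact (h z).expand_y x hx y hy y' hy'
  concave_y x hx y hy y' hy' := by
    have h1 : Integrable (fun z => inner ℝ (y' - y) (gy x y z)) P := (hgy x hx y hy).const_inner _
    have h2 : Integrable (fun z => f x y z + inner ℝ (y' - y) (gy x y z)) P := (hf x hx y hy).add h1
    have h3 := integral_mono (hf x hx y' hy') (h2.sub (integrable_const (μ / 2 * ‖y' - y‖ ^ 2)))
      (fun z => by
        have := (h z).concave_y x hx y hy y' hy'
        rw [real_inner_comm] at this
        exact this)
    simp only [Pi.sub_apply] at h3
    rw [integral_sub h2 (integrable_const _), integral_add (hf x hx y hy) h1,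
      integral_inner (hgy x hx y hy), real_inner_comm] at h3
    simpa using h3
  lip_x x hx x' hx' y hy y' hy' := by
    rw [← integral_sub (hgx x hx y hy) (hgx x' hx' y' hy')]
    exact (norm_integral_le_of_norm_le_const
      (Filter.Eventually.of_forall fun z => (h z).lip_x x hx x' hx' y hy y' hy')).trans (by simp)
  lip_y x hx x' hx' y hy y' hy' := by
    rw [← integral_sub (hgy x hx y hy) (hgy x' hx' y' hy')]
    exact (norm_integral_le_of_norm_le_const
      (Filter.Eventually.of_forall fun z => (h z).lip_y x hx x' hx' y hy y' hy')).trans (by simp)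

theorem continuousOn_y (h : SCSmooth X Y β μ G gx gy) {x : E d} (hx : x ∈ X) :
    ContinuousOn (G x) Y := fun y hy =>
  (hasFDerivWithinAt_of_quadratic (h.expand_y x hx y hy)).continuousWithinAt

theorem continuousOn_x (h : SCSmooth X Y β μ G gx gy) {y : E d'} (hy : y ∈ Y) :
    ContinuousOn (fun x => G x y) X := fun x hx =>
  (hasFDerivWithinAt_of_quadratic (φ := fun x => G x y) (h.expand_x y hy x hx)).continuousWithinAt

theorem exists_isMaxOn (h : SCSmooth X Y β μ G gx gy) (hY : IsCompact Y) (hne : Y.Nonempty) :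
    ∃ ystar : E d → E d', ∀ x ∈ X, ystar x ∈ Y ∧ IsMaxOn (G x) Y (ystar x) := by
  have : ∀ x : E d, ∃ y, x ∈ X → y ∈ Y ∧ IsMaxOn (G x) Y y := fun x => by
    by_cases hx : x ∈ X
    · obtain ⟨y, hy⟩ := hY.exists_isMaxOn hne (h.continuousOn_y hx)
      exact ⟨y, fun _ => hy⟩
    · exact ⟨0, fun h => absurd h hx⟩
  choose ystar hy using this
  exact ⟨ystar, hy⟩

theorem primal_eq {x : E d} {y : E d'} (hy : y ∈ Y) (hmax : IsMaxOn (G x) Y y) :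
    primal Y G x = G x y := by
  refine IsGreatest.csSup_eq ⟨Set.mem_image_of_mem _ hy, ?_⟩
  rintro _ ⟨y', hy', rfl⟩
  exact hmax hy'

theorem variational_y (h : SCSmooth X Y β μ G gx gy) (hY : Convex ℝ Y) {x : E d} (hx : x ∈ X)
    {y : E d'} (hy : y ∈ Y) (hmax : IsMaxOn (G x) Y y) {y' : E d'} (hy' : y' ∈ Y) :
    inner ℝ (gy x y) (y' - y) ≤ 0 := by
  refine le_zero_of_forall_le_mul (C := β / 2 * ‖y' - y‖ ^ 2) fun t ht0 ht1 => ?_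
  have hm : y + t • (y' - y) ∈ Y := hY.add_smul_sub_mem hy hy' ⟨ht0.le, ht1.le⟩
  have h1 := (abs_le.1 (h.expand_y x hx y hy _ hm)).1
  have h2 : G x (y + t • (y' - y)) ≤ G x y := hmax hm
  rw [add_sub_cancel_left, inner_smul_right, norm_smul, Real.norm_of_nonneg ht0.le] at h1
  have h3 : t * inner ℝ (gy x y) (y' - y) ≤ t * (t * (β / 2 * ‖y' - y‖ ^ 2)) := by linarith
  exact le_of_mul_le_mul_left h3 ht0

/-- Stability of the maximizer of a strongly concave function under perturbations. -/
theorem norm_sub_argmax_le (h : SCSmooth X Y β μ G gx gy) {G' : E d → E d' → ℝ} {β' μ' : ℝ}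
    {gx' : E d → E d' → E d} {gy' : E d → E d' → E d'} (h' : SCSmooth X Y β' μ' G' gx' gy')
    (hY : Convex ℝ Y) {x x' : E d} (hx : x ∈ X)
    (hx' : x' ∈ X) {y y' : E d'} (hy : y ∈ Y) (hy' : y' ∈ Y) (hmax : IsMaxOn (G x) Y y)
    (hmax' : IsMaxOn (G' x') Y y') : μ' * ‖y' - y‖ ≤ ‖gy' x' y - gy x y‖ := by
  have h1 := h.variational_y hY hx hy hmax hy'
  have h2 := h'.variational_y hY hx' hy' hmax' hy
  have h3 := h'.concave_y x' hx' y hy y' hy'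
  have h4 := h'.concave_y x' hx' y' hy' y hy
  rw [norm_sub_rev] at h4
  -- Add strong concavity of `G' x'` in both directions and the two optimality conditions.
  have h5 : μ' * ‖y' - y‖ ^ 2 ≤ inner ℝ (gy' x' y - gy x y) (y' - y) := by
    rw [inner_sub_left]; linarith
  have h6 := h5.trans (real_inner_le_norm _ _)
  rcases (norm_nonneg (y' - y)).eq_or_lt with h0 | h0
  · rw [← h0, mul_zero]; exact norm_nonneg _
  · rw [pow_two, ← mul_assoc] at h6
    exact le_of_mul_le_mul_right h6 h0

theorem argmax_lipschitz (h : SCSmooth X Y β μ G gx gy) (hμ : 0 < μ) (hY : Convex ℝ Y) {x x' : E d}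
    (hx : x ∈ X) (hx' : x' ∈ X) {y y' : E d'} (hy : y ∈ Y) (hy' : y' ∈ Y)
    (hmax : IsMaxOn (G x) Y y) (hmax' : IsMaxOn (G x') Y y') :
    ‖y' - y‖ ≤ β / μ * ‖x' - x‖ := by
  have h1 := h.norm_sub_argmax_le h hY hx hx' hy hy' hmax hmax'
  have h2 := h.lip_y x' hx' x hx y hy y hy
  rw [sub_self, norm_zero, add_zero] at h2
  rw [div_mul_eq_mul_div, le_div_iff₀ hμ]
  linarith

/-- Danskin's theorem, with a quadratic error term. -/
theorem primal_expand (h : SCSmooth X Y β μ G gx gy) (hβ : 0 < β) (hμ : 0 < μ) (hY : Convex ℝ Y)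
    {x x' : E d} (hx : x ∈ X) (hx' : x' ∈ X) {y y' : E d'} (hy : y ∈ Y) (hy' : y' ∈ Y)
    (hmax : IsMaxOn (G x) Y y) (hmax' : IsMaxOn (G x') Y y') :
    |primal Y G x' - primal Y G x - inner ℝ (gx x y) (x' - x)|
      ≤ (β / 2 + β * (β / μ)) * ‖x' - x‖ ^ 2 := by
  rw [primal_eq hy hmax, primal_eq hy' hmax', abs_le]
  have h1 := (abs_le.1 (h.expand_x y hy x hx x' hx')).1
  have h2 := (abs_le.1 (h.expand_x y' hy' x hx x' hx')).2
  have h3 : G x' y ≤ G x' y' := hmax' hy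
  have h4 : G x y' ≤ G x y := hmax hy'
  -- The increment of the primal function lies between those of `G` at fixed `y` and at fixed `y'`;
  -- Lipschitz continuity of the argmax makes the difference of their slopes second order.
  have h5 : inner ℝ (gx x y') (x' - x) - inner ℝ (gx x y) (x' - x)
      ≤ β * (β / μ) * ‖x' - x‖ ^ 2 := by
    rw [← inner_sub_left]
    refine (real_inner_le_norm _ _).trans ?_
    have h6 := h.lip_x x hx x hx y' hy' y hy
    rw [sub_self, norm_zero, zero_add] at h6
    have h7 := h.argmax_lipschitz hμ hY hx hx' hy hy' hmax hmax'
    calc _ ≤ β * (β / μ * ‖x' - x‖) * ‖x' - x‖ := by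
          gcongr
          exact h6.trans (by gcongr)
      _ = _ := by ring
  have h8 : 0 ≤ β * (β / μ) * ‖x' - x‖ ^ 2 := by positivity
  constructor <;> linarith

theorem variational_x (h : SCSmooth X Y β μ G gx gy) (hβ : 0 < β) (hμ : 0 < μ) (hX : Convex ℝ X)
    (hY : Convex ℝ Y) (hYc : IsCompact Y) {x x' : E d} {y : E d'}
    (hsol : IsMinimaxSol X Y G x y) (hx' : x' ∈ X) : 0 ≤ inner ℝ (gx x y) (x' - x) := by
  obtain ⟨hx, hy, hmin, hmax⟩ := hsol
  obtain ⟨ystar, hstar⟩ := h.exists_isMaxOn hYc ⟨y, hy⟩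
  suffices hs : -inner ℝ (gx x y) (x' - x) ≤ 0 by linarith
  refine le_zero_of_forall_le_mul (C := (β / 2 + β * (β / μ)) * ‖x' - x‖ ^ 2) fun t ht0 ht1 => ?_
  have hm : x + t • (x' - x) ∈ X := hX.add_smul_sub_mem hx hx' ⟨ht0.le, ht1.le⟩
  obtain ⟨hy', hmax'⟩ := hstar _ hm
  have h1 := (abs_le.1 (h.primal_expand hβ hμ hY hx hm hy hy' hmax hmax')).2
  have h2 : primal Y G x ≤ primal Y G (x + t • (x' - x)) := hmin hm
  rw [add_sub_cancel_left, inner_smul_right, norm_smul, Real.norm_of_nonneg ht0.le] at h1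
  have h3 : t * -inner ℝ (gx x y) (x' - x)
      ≤ t * (t * ((β / 2 + β * (β / μ)) * ‖x' - x‖ ^ 2)) := by linarith
  exact le_of_mul_le_mul_left h3 ht0

end SCSmooth

/-- A Polyak-Lojasiewicz function on a compact set, whose descent directions are feasible and
whose minimizer is unique, grows quadratically. -/
theorem quadratic_growth {X : Set (E d)} (hXc : IsCompact X) (hX : Convex ℝ X) {Φ : E d → ℝ}
    {g : E d → E d} {C μ : ℝ} (hμ : 0 < μ) {xs : E d} (hxs : xs ∈ X)
    (hexp : ∀ x ∈ X, ∀ x' ∈ X, |Φ x' - Φ x - inner ℝ (g x) (x' - x)| ≤ C * ‖x' - x‖ ^ 2)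
    (hmin : ∀ x ∈ X, Φ xs ≤ Φ x) (huniq : ∀ x ∈ X, Φ x = Φ xs → x = xs)
    (hPL : ∀ x ∈ X, Φ x - Φ xs ≤ 1 / (2 * μ) * ‖g x‖ ^ 2)
    (hdesc : ∀ x ∈ X, ∃ η : ℝ, 0 < η ∧ x - η • g x ∈ X) {x : E d} (hx : x ∈ X) :
    μ / 2 * ‖x - xs‖ ^ 2 ≤ Φ x - Φ xs := by
  by_contra! hcon
  have hne : 0 < ‖x - xs‖ := by
    rcases (norm_nonneg (x - xs)).eq_or_lt with h | h
    · rw [← h] at hcon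
      have := hmin x hx
      linarith
    · exact h
  set ψ : E d → ℝ := fun x => √(Φ x - Φ xs) with hψ
  -- PL says that `ψ`, the square root of the gap, has slope at least `√(μ/2)`. If growth fails at
  -- `x`, some `α` below that slope still satisfies `ψ x < α ‖x - xs‖`.
  obtain ⟨α, hα0, hα, hαx⟩ : ∃ α, 0 < α ∧ 2 * α ^ 2 < μ ∧ ψ x < α * ‖x - xs‖ := by
    have h1 : ψ x / ‖x - xs‖ < √(μ / 2) := by
      rw [div_lt_iff₀ hne]
      refine Real.sqrt_lt_sqrt (sub_nonneg.2 (hmin x hx)) hcon |>.trans_le ?_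
      rw [Real.sqrt_mul (by positivity), Real.sqrt_sq hne.le]
    obtain ⟨α, h2, h3⟩ := exists_between h1
    have hα0 : 0 < α := (div_nonneg (Real.sqrt_nonneg _) hne.le).trans_lt h2
    refine ⟨α, hα0, ?_, (div_lt_iff₀ hne).1 h2⟩
    have := (Real.lt_sqrt hα0.le).1 h3
    linarith
  have hcont : ContinuousOn Φ X := fun x hx =>
    (hasFDerivWithinAt_of_quadratic (hexp x hx)).continuousWithinAt
  have hc2 : ContinuousOn (fun a => ψ a + α * ‖a - x‖) X :=
    ((hcont.sub continuousOn_const).sqrt).add (by fun_prop)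
  -- Ekeland's argument: the minimizer `a` of the penalized function cannot be `xs`, by the choice
  -- of `α`, so the gap at `a` is positive; yet `ψ` has slope at most `α` there.
  obtain ⟨a, ha, hamin⟩ := hXc.exists_isMinOn ⟨x, hx⟩ hc2
  have ha1 : ψ a + α * ‖a - x‖ ≤ ψ x := by
    have : ψ a + α * ‖a - x‖ ≤ ψ x + α * ‖x - x‖ := hamin hx
    simpa using this
  have hane : a ≠ xs := by
    rintro rfl
    have h2 : 0 ≤ ψ a := Real.sqrt_nonneg _
    rw [norm_sub_rev] at ha1
    linarith
  have hgap : 0 < Φ a - Φ xs := by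
    rcases (sub_nonneg.2 (hmin a ha)).eq_or_lt with h | h
    · exact absurd (huniq a ha (by linarith)) hane
    · exact h
  have hψa : 0 < ψ a := Real.sqrt_pos.2 hgap
  have hψsq : ψ a ^ 2 = Φ a - Φ xs := Real.sq_sqrt hgap.le
  have hga : 2 * μ * ψ a ^ 2 ≤ ‖g a‖ ^ 2 := by
    have := hPL a ha
    rw [← hψsq, one_div_mul_eq_div, le_div_iff₀ (by positivity)] at this
    linarith
  have hgpos : 0 < ‖g a‖ := by
    have : 0 < ‖g a‖ ^ 2 := lt_of_lt_of_le (by positivity) hga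
    exact lt_of_pow_lt_pow_left₀ 2 (norm_nonneg _) (by simpa using this)
  obtain ⟨η, hη, hηX⟩ := hdesc a ha
  -- Compare `a` with the feasible point `a - τ g(a)` and let the step tend to zero. The result, `‖g
  -- a‖ ≤ 2 α ψ a`, contradicts PL.
  have key : ‖g a‖ ^ 2 - 2 * α * ψ a * ‖g a‖ ≤ 0 := by
    refine le_zero_of_forall_le_mul (C := η * (C + α ^ 2) * ‖g a‖ ^ 2) fun t ht0 ht1 => ?_
    have hm : a + t • (a - η • g a - a) ∈ X := hX.add_smul_sub_mem ha hηX ⟨ht0.le, ht1.le⟩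
    have e : a + t • (a - η • g a - a) = a - (t * η) • g a := by module
    rw [e] at hm
    set τ := t * η with hτ
    have hτ0 : 0 < τ := by positivity
    have h1 : ψ a + α * ‖a - x‖ ≤ ψ (a - τ • g a) + α * ‖a - τ • g a - x‖ := hamin hm
    have h2 : ‖a - τ • g a - x‖ ≤ ‖a - x‖ + τ * ‖g a‖ := by
      rw [show a - τ • g a - x = (a - x) - τ • g a by abel]
      refine (norm_sub_le _ _).trans ?_
      rw [norm_smul, Real.norm_of_nonneg hτ0.le]
    have h3 : ψ a - α * (τ * ‖g a‖) ≤ ψ (a - τ • g a) := by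
      have := mul_le_mul_of_nonneg_left h2 hα0.le
      linarith
    have h4 := (abs_le.1 (hexp a ha _ hm)).2
    rw [show a - τ • g a - a = -(τ • g a) by abel, norm_neg, norm_smul,
      Real.norm_of_nonneg hτ0.le, inner_neg_right, inner_smul_right,
      real_inner_self_eq_norm_sq] at h4
    have h5 : ψ (a - τ • g a) ^ 2 = Φ (a - τ • g a) - Φ xs :=
      Real.sq_sqrt (sub_nonneg.2 (hmin _ hm))
    have h6 : ψ a ^ 2 - 2 * α * ψ a * (τ * ‖g a‖) ≤
        ψ (a - τ • g a) ^ 2 + α ^ 2 * (τ * ‖g a‖) ^ 2 := by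
      have h8 : 0 ≤ ψ (a - τ • g a) := Real.sqrt_nonneg _
      have h9 : 0 ≤ α * (τ * ‖g a‖) := by positivity
      rcases le_total 0 (ψ a - α * (τ * ‖g a‖)) with h10 | h10
      · nlinarith [pow_le_pow_left₀ h10 h3 2]
      · nlinarith
    have h7 : τ * (‖g a‖ ^ 2 - 2 * α * ψ a * ‖g a‖)
        ≤ τ * (t * (η * (C + α ^ 2) * ‖g a‖ ^ 2)) := by
      rw [h5, hψsq] at h6
      calc _ ≤ C * (τ * ‖g a‖) ^ 2 + α ^ 2 * (τ * ‖g a‖) ^ 2 := by linarith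
        _ = _ := by rw [hτ]; ring
    exact le_of_mul_le_mul_left h7 hτ0
  have h1 : ‖g a‖ ≤ 2 * α * ψ a := by
    have : ‖g a‖ * ‖g a‖ ≤ 2 * α * ψ a * ‖g a‖ := by linarith
    exact le_of_mul_le_mul_right this hgpos
  have h2 : ‖g a‖ ^ 2 ≤ (2 * α * ψ a) ^ 2 := pow_le_pow_left₀ hgpos.le h1 2
  have h3 : 0 < ψ a ^ 2 := by positivity
  nlinarith

/-- The primal gradient at an empirical solution is controlled by the deviation of the partial
gradients. -/
theorem norm_primal_gradient_le {X : Set (E d)} {Y : Set (E d')} (hX : Convex ℝ X)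
    (hY : Convex ℝ Y) (hYc : IsCompact Y) {β μ : ℝ} (hβ : 0 < β) (hμ : 0 < μ)
    {G G' : E d → E d' → ℝ} {gx gx' : E d → E d' → E d} {gy gy' : E d → E d' → E d'}
    (h : SCSmooth X Y β μ G gx gy) (h' : SCSmooth X Y β μ G' gx' gy') {x : E d} {y y' : E d'}
    (hsol : IsMinimaxSol X Y G' x y') (hy : y ∈ Y) (hmax : IsMaxOn (G x) Y y)
    (hdesc : ∃ η : ℝ, 0 < η ∧ x - η • gx x y ∈ X) :
    ‖gx x y‖ ≤ ‖gx' x y - gx x y‖ + β / μ * ‖gy' x y - gy x y‖ := by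
  obtain ⟨η, hη, hηX⟩ := hdesc
  have h1 := h'.variational_x hβ hμ hX hY hYc hsol hηX
  obtain ⟨hx, hy', -, hmax'⟩ := hsol
  rw [show x - η • gx x y - x = -(η • gx x y) by abel, inner_neg_right, inner_smul_right] at h1
  -- The empirical first-order condition tested in the population descent direction. It makes `‖gx x
  -- y‖` at most the distance between the two gradients.
  have h2 : inner ℝ (gx' x y') (gx x y) ≤ 0 := by
    by_contra! h3
    have := mul_pos hη h3
    linarith
  have h3 : ‖gx x y‖ ^ 2 ≤ ‖gx x y - gx' x y'‖ * ‖gx x y‖ := by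
    refine le_trans ?_ (real_inner_le_norm _ _)
    rw [inner_sub_left, real_inner_self_eq_norm_sq]
    linarith
  have h4 : ‖gx x y‖ ≤ ‖gx x y - gx' x y'‖ := by
    rcases (norm_nonneg (gx x y)).eq_or_lt with h0 | h0
    · rw [← h0]; exact norm_nonneg _
    · rw [pow_two] at h3
      exact le_of_mul_le_mul_right h3 h0
  have h5 := norm_sub_le_norm_sub_add_norm_sub (gx x y) (gx' x y) (gx' x y')
  rw [norm_sub_rev (gx x y) (gx' x y)] at h5
  have h6 := h'.lip_x x hx x hx y hy y' hy'
  rw [sub_self, norm_zero, zero_add, norm_sub_rev y y'] at h6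
  have h7 := h.norm_sub_argmax_le h' hY hx hx hy hy' hmax hmax'
  have h8 : β * ‖y' - y‖ ≤ β / μ * ‖gy' x y - gy x y‖ := by
    calc β * ‖y' - y‖ = β / μ * (μ * ‖y' - y‖) := by field_simp
      _ ≤ _ := by gcongr
  linarith

end Deterministic

/-! ### From the standing assumptions to a deterministic bound on the primal gradient. -/

section Problem

variable {d d' : ℕ} {Z : Type*} {X : Set (E d)} {Y : Set (E d')} {f : E d → E d' → Z → ℝ}
  {β : ℝ}

namespace IsSmoothOn

theorem norm_gradX_sub_le (h : IsSmoothOn β X Y f) (hβ : 0 ≤ β) {x₁ x₂ : E d} {y₁ y₂ : E d'}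
    (hx₁ : x₁ ∈ X) (hx₂ : x₂ ∈ X) (hy₁ : y₁ ∈ Y) (hy₂ : y₂ ∈ Y) (z : Z) :
    ‖gradX X f x₁ y₁ z - gradX X f x₂ y₂ z‖ ≤ β * (‖x₁ - x₂‖ + ‖y₁ - y₂‖) := by
  have h1 := (h z).2 x₁ hx₁ x₂ hx₂ y₁ hy₁ y₂ hy₂
  refine le_of_sq_le_sq ?_ (by positivity)
  have h2 : 0 ≤ β ^ 2 * (2 * (‖x₁ - x₂‖ * ‖y₁ - y₂‖)) := by positivity
  nlinarith [sq_nonneg ‖gradY Y f x₁ y₁ z - gradY Y f x₂ y₂ z‖]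

theorem norm_gradY_sub_le (h : IsSmoothOn β X Y f) (hβ : 0 ≤ β) {x₁ x₂ : E d} {y₁ y₂ : E d'}
    (hx₁ : x₁ ∈ X) (hx₂ : x₂ ∈ X) (hy₁ : y₁ ∈ Y) (hy₂ : y₂ ∈ Y) (z : Z) :
    ‖gradY Y f x₁ y₁ z - gradY Y f x₂ y₂ z‖ ≤ β * (‖x₁ - x₂‖ + ‖y₁ - y₂‖) := by
  have h1 := (h z).2 x₁ hx₁ x₂ hx₂ y₁ hy₁ y₂ hy₂
  refine le_of_sq_le_sq ?_ (by positivity)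
  have h2 : 0 ≤ β ^ 2 * (2 * (‖x₁ - x₂‖ * ‖y₁ - y₂‖)) := by positivity
  nlinarith [sq_nonneg ‖gradX X f x₁ y₁ z - gradX X f x₂ y₂ z‖]

theorem expand_x (h : IsSmoothOn β X Y f) (hβ : 0 ≤ β) (hX : Convex ℝ X) {x x' : E d} {y : E d'}
    (hx : x ∈ X) (hx' : x' ∈ X) (hy : y ∈ Y) (z : Z) :
    |f x' y z - f x y z - inner ℝ (gradX X f x y z) (x' - x)| ≤ β / 2 * ‖x' - x‖ ^ 2 := by
  refine quadratic_of_lipschitz_gradient (φ := fun x' => f x' y z) hX ?_ (fun a ha b hb => ?_) hx hx'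
  · exact (h z).1.comp (f := fun x' => (x', y)) (by fun_prop) (fun a ha => ⟨ha, hy⟩)
  · have := h.norm_gradX_sub_le hβ ha hb hy hy z
    rwa [sub_self, norm_zero, add_zero] at this

theorem expand_y (h : IsSmoothOn β X Y f) (hβ : 0 ≤ β) (hY : Convex ℝ Y) {x : E d} {y y' : E d'}
    (hx : x ∈ X) (hy : y ∈ Y) (hy' : y' ∈ Y) (z : Z) :
    |f x y' z - f x y z - inner ℝ (gradY Y f x y z) (y' - y)| ≤ β / 2 * ‖y' - y‖ ^ 2 := by
  refine quadratic_of_lipschitz_gradient (φ := fun y' => f x y' z) hY ?_ (fun a ha b hb => ?_) hy hy'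
  · exact (h z).1.comp (f := fun y' => (x, y')) (by fun_prop) (fun a ha => ⟨hx, ha⟩)
  · have := h.norm_gradY_sub_le hβ hx hx ha hb z
    rwa [sub_self, norm_zero, zero_add] at this

theorem scSmooth (h : IsSmoothOn β X Y f) (hβ : 0 ≤ β) (hX : Convex ℝ X) (hY : Convex ℝ Y) {μ : ℝ}
    (hc : ∀ x ∈ X, ∀ z : Z, StrongConcaveOn Y μ (fun y => f x y z)) (z : Z) :
    SCSmooth X Y β μ (fun x y => f x y z) (fun x y => gradX X f x y z)
      (fun x y => gradY Y f x y z) where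
  expand_x _ hy _ hx _ hx' := h.expand_x hβ hX hx hx' hy z
  expand_y _ hx _ hy _ hy' := h.expand_y hβ hY hx hy hy' z
  concave_y x hx _ hy _ hy' := strongConcave_first_order (φ := fun y => f x y z) (hc x hx z) hy
    (fun _ hy' => h.expand_y hβ hY hx hy hy' z) hy'
  lip_x _ hx _ hx' _ hy _ hy' := h.norm_gradX_sub_le hβ hx hx' hy hy' z
  lip_y _ hx _ hx' _ hy _ hy' := h.norm_gradY_sub_le hβ hx hx' hy hy' z

end IsSmoothOn

theorem integral_uniform_fin {V : Type*} [NormedAddCommGroup V] [NormedSpace ℝ V]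
    [CompleteSpace V] {n : ℕ} (g : Fin n → V) :
    ∫ i, g i ∂((n : ENNReal)⁻¹ • (Measure.count : Measure (Fin n))) = (1 / (n : ℝ)) • ∑ i, g i := by
  rw [integral_smul_measure, integral_count]
  simp

variable [MeasurableSpace Z] {P : Measure Z} {μx μy Bx By R₁ : ℝ} {xs : E d} {ys : E d'}

/-- The partial gradient in `x` of the population risk. -/
def popGradX (X : Set (E d)) (P : Measure Z) (f : E d → E d' → Z → ℝ) (x : E d) (y : E d') : E d :=
  ∫ z, gradX X f x y z ∂P

/-- The partial gradient in `y` of the population risk. -/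
def popGradY (Y : Set (E d')) (P : Measure Z) (f : E d → E d' → Z → ℝ) (x : E d) (y : E d') :
    E d' :=
  ∫ z, gradY Y f x y z ∂P

namespace Setting

variable (h : Setting X Y P f β μx μy Bx By R₁ xs ys)
include h

theorem scSmooth (z : Z) : SCSmooth X Y β μy (fun x y => f x y z) (fun x y => gradX X f x y z)
    (fun x y => gradY Y f x y z) :=
  h.smooth.scSmooth h.β_pos.le h.convex_X h.convex_Y h.strongConcave z

theorem integrable_gradX {x : E d} {y : E d'} (hx : x ∈ X) (hy : y ∈ Y) :
    Integrable (gradX X f x y) P :=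
  haveI := h.prob
  integrable_gradient (φ := fun x' z => f x' y z) h.convex_X h.interior_X hx
    (fun x' hx' => h.integrable x' hx' y hy) (fun _ hx' z => (h.scSmooth z).expand_x y hy x hx _ hx')

theorem integrable_gradY {x : E d} {y : E d'} (hx : x ∈ X) (hy : y ∈ Y) :
    Integrable (gradY Y f x y) P :=
  haveI := h.prob
  integrable_gradient (φ := fun y' z => f x y' z) h.convex_Y h.interior_Y hy
    (fun y' hy' => h.integrable x hx y' hy') (fun _ hy' z => (h.scSmooth z).expand_y x hx y hy _ hy')

theorem scSmooth_popRisk :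
    SCSmooth X Y β μy (popRisk P f) (popGradX X P f) (popGradY Y P f) :=
  haveI := h.prob
  SCSmooth.integral h.scSmooth h.integrable (fun _ hx _ hy => h.integrable_gradX hx hy)
    (fun _ hx _ hy => h.integrable_gradY hx hy)

theorem scSmooth_empRisk {n : ℕ} (hn : n ≠ 0) (S : Fin n → Z) :
    SCSmooth X Y β μy (empRisk f S) (fun x y => (1 / (n : ℝ)) • ∑ i, gradX X f x y (S i))
      (fun x y => (1 / (n : ℝ)) • ∑ i, gradY Y f x y (S i)) := by
  have : IsProbabilityMeasure ((n : ENNReal)⁻¹ • (Measure.count : Measure (Fin n))) := ⟨by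
    rw [Measure.smul_apply, Measure.count_univ, smul_eq_mul, ENat.card_eq_coe_fintype_card,
      Fintype.card_fin]
    exact ENNReal.inv_mul_cancel (by exact_mod_cast hn) (by simp)⟩
  have hint : ∀ {V : Type} [NormedAddCommGroup V] (g : Fin n → V),
      Integrable g ((n : ENNReal)⁻¹ • (Measure.count : Measure (Fin n))) := fun g =>
    Integrable.of_finite
  have := SCSmooth.integral (P := (n : ENNReal)⁻¹ • (Measure.count : Measure (Fin n)))
    (fun i => h.scSmooth (S i)) (fun _ _ _ _ => hint _) (fun _ _ _ _ => hint _)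
    (fun _ _ _ _ => hint _)
  simp_rw [integral_uniform_fin] at this
  exact this

theorem exists_argmax : ∃ ystar : E d → E d', (∀ x ∈ X, ystar x ∈ Y ∧
    IsMaxOn (popRisk P f x) Y (ystar x)) ∧ ystar xs = ys := by
  obtain ⟨hxs, hys, -, hmax⟩ := h.sol
  obtain ⟨ystar, hy⟩ := h.scSmooth_popRisk.exists_isMaxOn h.compact_Y ⟨ys, hys⟩
  refine ⟨ystar, hy, ?_⟩
  have := h.scSmooth_popRisk.argmax_lipschitz h.μy_pos h.convex_Y hxs hxs hys (hy xs hxs).1 hmax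
    (hy xs hxs).2
  rw [sub_self, norm_zero, mul_zero] at this
  exact sub_eq_zero.1 (norm_le_zero_iff.1 this)

theorem primal_xs : primal Y (popRisk P f) xs = popRisk P f xs ys :=
  SCSmooth.primal_eq h.sol.2.1 h.sol.2.2.2

variable {ystar : E d → E d'}
  (hy : ∀ x ∈ X, ystar x ∈ Y ∧ IsMaxOn (popRisk P f x) Y (ystar x))
include hy

theorem primal_expand {x x' : E d} (hx : x ∈ X) (hx' : x' ∈ X) :
    |primal Y (popRisk P f) x' - primal Y (popRisk P f) x
        - inner ℝ (popGradX X P f x (ystar x)) (x' - x)|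
      ≤ (β / 2 + β * (β / μy)) * ‖x' - x‖ ^ 2 :=
  h.scSmooth_popRisk.primal_expand h.β_pos h.μy_pos h.convex_Y hx hx' (hy x hx).1 (hy x' hx').1
    (hy x hx).2 (hy x' hx').2

theorem gradientWithin_primal {x : E d} (hx : x ∈ X) :
    gradientWithin (primal Y (popRisk P f)) X x = popGradX X P f x (ystar x) :=
  gradientWithin_eq_of_quadratic h.convex_X h.interior_X hx fun _ hx' => h.primal_expand hy hx hx'

theorem descent' {x : E d} (hx : x ∈ X) :
    ∃ η : ℝ, 0 < η ∧ x - η • popGradX X P f x (ystar x) ∈ X := by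
  have := h.descent x hx
  rwa [h.gradientWithin_primal hy hx] at this

/-- Apply the PL condition at `y = ystar x`: the infimum over `X` is at most `F(xs, ystar x)`, which
is at most `F(xs, ys)`. -/
theorem primal_pl {x : E d} (hx : x ∈ X) :
    primal Y (popRisk P f) x - primal Y (popRisk P f) xs
      ≤ 1 / (2 * μx) * ‖popGradX X P f x (ystar x)‖ ^ 2 := by
  obtain ⟨hyx, hmax⟩ := hy x hx
  have hsc := h.scSmooth_popRisk
  have h1 := h.pl (ystar x) hyx x hx
  rw [gradientWithin_eq_of_quadratic (φ := fun x' => popRisk P f x' (ystar x)) h.convex_X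
    h.interior_X hx (hsc.expand_x (ystar x) hyx x hx)] at h1
  rw [SCSmooth.primal_eq hyx hmax]
  have hbdd : BddBelow ((fun x' => popRisk P f x' (ystar x)) '' X) :=
    (h.compact_X.image_of_continuousOn (hsc.continuousOn_x hyx)).bddBelow
  have h2 : sInf ((fun x' => popRisk P f x' (ystar x)) '' X) ≤ popRisk P f xs (ystar x) :=
    csInf_le hbdd ⟨xs, h.sol.1, rfl⟩
  have h3 : popRisk P f xs (ystar x) ≤ popRisk P f xs ys := h.sol.2.2.2 hyx
  rw [h.primal_xs]
  linarith

/-- Chain quadratic growth with the PL inequality. -/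
theorem norm_sub_le_norm_grad {x : E d} (hx : x ∈ X) :
    μx * ‖x - xs‖ ≤ ‖popGradX X P f x (ystar x)‖ := by
  have hμ := h.μx_pos
  have h1 := quadratic_growth h.compact_X h.convex_X h.μx_pos h.sol.1
    (g := fun x => popGradX X P f x (ystar x)) (fun x hx x' hx' => h.primal_expand hy hx hx')
    (fun x hx => h.sol.2.2.1 hx) h.unique (fun x hx => h.primal_pl hy hx)
    (fun x hx => h.descent' hy hx) hx
  have h2 := h1.trans (h.primal_pl hy hx)
  refine le_of_sq_le_sq ?_ (norm_nonneg _)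
  rw [one_div_mul_eq_div, le_div_iff₀ (by positivity)] at h2
  linarith

/-- The constraint may be active at `xs`, but the feasible descent step still forces stationarity:
compare the population problem with itself, so that all deviations vanish. -/
theorem popGradX_xs : popGradX X P f xs ys = 0 := by
  obtain ⟨hxs, hys, -, hmax⟩ := h.sol
  have e : ystar xs = ys := by
    have := h.scSmooth_popRisk.argmax_lipschitz h.μy_pos h.convex_Y hxs hxs hys (hy xs hxs).1 hmax
      (hy xs hxs).2
    rw [sub_self, norm_zero, mul_zero] at this
    exact sub_eq_zero.1 (norm_le_zero_iff.1 this)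
  have hd := h.descent' hy hxs
  rw [e] at hd
  have := norm_primal_gradient_le h.convex_X h.convex_Y h.compact_Y h.β_pos h.μy_pos
    h.scSmooth_popRisk h.scSmooth_popRisk h.sol hys hmax hd
  simpa using this

theorem lipschitz_gradX_argmax {x x' : E d} (hx : x ∈ X) (hx' : x' ∈ X) (z : Z) :
    ‖gradX X f x (ystar x) z - gradX X f x' (ystar x') z‖ ≤ β * (1 + β / μy) * ‖x - x'‖ := by
  have h1 := (h.scSmooth z).lip_x x hx x' hx' _ (hy x hx).1 _ (hy x' hx').1
  have h2 := h.scSmooth_popRisk.argmax_lipschitz h.μy_pos h.convex_Y hx' hx (hy x' hx').1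
    (hy x hx).1 (hy x' hx').2 (hy x hx).2
  have h3 := mul_le_mul_of_nonneg_left h2 h.β_pos.le
  linarith

theorem lipschitz_gradY_argmax {x x' : E d} (hx : x ∈ X) (hx' : x' ∈ X) (z : Z) :
    ‖gradY Y f x (ystar x) z - gradY Y f x' (ystar x') z‖ ≤ β * (1 + β / μy) * ‖x - x'‖ := by
  have h1 := (h.scSmooth z).lip_y x hx x' hx' _ (hy x hx).1 _ (hy x' hx').1
  have h2 := h.scSmooth_popRisk.argmax_lipschitz h.μy_pos h.convex_Y hx' hx (hy x' hx').1
    (hy x hx).1 (hy x' hx').2 (hy x hx).2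
  have h3 := mul_le_mul_of_nonneg_left h2 h.β_pos.le
  linarith

/-- The condition number is at least 1, because the gradient of the primal function vanishes at
`xs`, grows at least like `μx‖x - xs‖` and is Lipschitz. A second point of `X` is needed. -/
theorem μx_le (he : ystar xs = ys) {x : E d} (hx : x ∈ X) (hne : x ≠ xs) :
    μx ≤ β * (1 + β / μy) := by
  have h1 := h.norm_sub_le_norm_grad hy hx
  have h2 := h.scSmooth_popRisk.lip_x x hx xs h.sol.1 _ (hy x hx).1 _ (hy xs h.sol.1).1
  have h4 := h.scSmooth_popRisk.argmax_lipschitz h.μy_pos h.convex_Y h.sol.1 hx (hy xs h.sol.1).1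
    (hy x hx).1 (hy xs h.sol.1).2 (hy x hx).2
  have h3 := mul_le_mul_of_nonneg_left h4 h.β_pos.le
  rw [he, h.popGradX_xs hy, sub_zero] at h2
  rw [he] at h3
  have h5 : 0 < ‖x - xs‖ := norm_pos_iff.2 (sub_ne_zero.2 hne)
  refine le_of_mul_le_mul_right ?_ h5
  linarith

/-- Deterministic core of the excess risk bound, on the event where all deviations are small. -/
theorem norm_grad_le_of_dev {n : ℕ} (hn : n ≠ 0) {S : Fin n → Z} (he : ystar xs = ys)
    {ε Dx Dy : ℝ} (hε : (1 + β / μy) * ε ≤ μx / 4) {x : E d} {y : E d'}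
    (hsol : IsMinimaxSol X Y (empRisk f S) x y)
    (hDx : ‖dev P (gradX X f xs ys) S‖ ≤ Dx) (hDy : ‖dev P (gradY Y f xs ys) S‖ ≤ Dy)
    (hx : ‖dev P (gradX X f x (ystar x)) S - dev P (gradX X f xs (ystar xs)) S‖
      ≤ ε * max ‖x - xs‖ (1 / n))
    (hyy : ‖dev P (gradY Y f x (ystar x)) S - dev P (gradY Y f xs (ystar xs)) S‖
      ≤ ε * max ‖x - xs‖ (1 / n)) :
    ‖popGradX X P f x (ystar x)‖ ≤ 4 / 3 * (Dx + β / μy * Dy) + μx / (3 * n) := by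
  have hxX := hsol.1
  have hβ := h.β_pos
  have hμ := h.μy_pos
  have h1 : ‖popGradX X P f x (ystar x)‖ ≤ ‖dev P (gradX X f x (ystar x)) S‖
      + β / μy * ‖dev P (gradY Y f x (ystar x)) S‖ :=
    norm_primal_gradient_le h.convex_X h.convex_Y h.compact_Y h.β_pos h.μy_pos
    h.scSmooth_popRisk (h.scSmooth_empRisk hn S) hsol (hy x hxX).1 (hy x hxX).2 (h.descent' hy hxX)
  rw [he] at hx hyy
  have h2 := (norm_sub_norm_le _ _).trans hx
  have h3 := (norm_sub_norm_le _ _).trans hyy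
  set m := max ‖x - xs‖ (1 / (n : ℝ))
  have h4 : β / μy * ‖dev P (gradY Y f x (ystar x)) S‖ ≤ β / μy * (Dy + ε * m) := by
    gcongr
    linarith
  -- This allows absorption: the uniform deviation contributes at most `μx m / 4`, a quarter of the
  -- gradient plus `μx/(4n)`. Dividing by `3/4` produces the constants `4/3` and `1/3`.
  have hm : μx * m ≤ ‖popGradX X P f x (ystar x)‖ + μx / n := by
    have h5 := h.norm_sub_le_norm_grad hy hxX
    have h6 : 0 ≤ μx / n := div_nonneg h.μx_pos.le n.cast_nonneg
    rcases max_cases ‖x - xs‖ (1 / (n : ℝ)) with ⟨e, -⟩ | ⟨e, -⟩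
    · simp only [m, e]; linarith
    · simp only [m, e]
      have := norm_nonneg (popGradX X P f x (ystar x))
      rw [mul_one_div]; linarith
  have hm0 : 0 ≤ m := le_max_of_le_left (norm_nonneg _)
  have h7 : (1 + β / μy) * ε * m ≤ μx / 4 * m := by gcongr
  have e : μx / (3 * n) = μx / n / 3 := by rw [div_div, mul_comm]
  rw [e]
  linarith

end Setting

end Problem

/-! ### The high-probability bound with explicit constants. -/

section Problem

variable {d d' : ℕ} {Z : Type*} {X : Set (E d)} {Y : Set (E d')} {f : E d → E d' → Z → ℝ}
  {β : ℝ} [MeasurableSpace Z] {P : Measure Z} {μx μy Bx By R₁ : ℝ} {xs : E d} {ys : E d'}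

/-- Here `w = √(2l/n)`, and `8l ≤ n` gives `w ≤ 1/2`. Hence `κ = 2 ≥ exp (1/2)` is allowed, which is
the origin of the factor `3/2`. -/
theorem Bernstein.measure_norm_dev_gt_le {V : Type*} [NormedAddCommGroup V]
    [InnerProductSpace ℝ V] [CompleteSpace V] [IsProbabilityMeasure P] {g : Z → V} {B : ℝ}
    (hg : AEStronglyMeasurable g P) (hB : 0 ≤ B) (h : Bernstein P g B) {n : ℕ} (hn : n ≠ 0)
    {l : ℝ} (hl : 0 ≤ l) (hln : 8 * l ≤ n) :
    Measure.pi (fun _ : Fin n => P) {S | 3 / 2 * √(∫ z, ‖g z‖ ^ 2 ∂P) * √(2 * l / n) + B * (l / n)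
      < ‖dev P g S‖} ≤ ENNReal.ofReal (2 * Real.exp (-l)) := by
  have hn0 : (0 : ℝ) < n := Nat.cast_pos.2 (Nat.pos_of_ne_zero hn)
  have hσ2 : √(∫ z, ‖g z‖ ^ 2 ∂P) ^ 2 = ∫ z, ‖g z‖ ^ 2 ∂P :=
    Real.sq_sqrt (integral_nonneg fun z => sq_nonneg _)
  have hw2 : √(2 * l / n) ^ 2 = 2 * l / n := Real.sq_sqrt (by positivity)
  have hσ := Real.sqrt_nonneg (∫ z, ‖g z‖ ^ 2 ∂P)
  have hw := Real.sqrt_nonneg (2 * l / n)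
  have hw1 : √(2 * l / n) ≤ 1 / 2 := by
    rw [Real.sqrt_le_left (by norm_num), div_le_iff₀ hn0]
    linarith
  generalize √(∫ z, ‖g z‖ ^ 2 ∂P) = σ at *
  generalize √(2 * l / n) = w at *
  have hκ : Real.exp (w * σ / (σ + B * w)) ≤ 2 := by
    have h1 : w * σ / (σ + B * w) ≤ 1 / 2 := by
      refine div_le_of_le_mul₀ (by positivity) (by norm_num) ?_
      nlinarith [mul_nonneg hB hw]
    refine (Real.exp_le_exp.2 h1).trans ?_
    have h2 : Real.exp (1 / 2) ^ 2 < 2.7182818286 := by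
      rw [← Real.exp_nat_mul]; norm_num
      exact Real.exp_one_lt_d9.trans_le (by norm_num)
    nlinarith [Real.exp_pos (1 / 2)]
  have := Minimax.measure_norm_dev_gt_le hg hσ hB hw hκ
    (fun k hk => by rw [hσ2]; exact h k hk) hn
  rw [hw2] at this
  convert this using 6
  · ring
  · ring
  · field_simp

/-- Take `M = ⌈log₂ v⌉` for the number of dyadic shells. The quarter of `δ` is the share of one of
four failure events, and `√2` supplies the `1/2` in `4(M + 1) ≤ 16 (log₂ v + 1/2)`. -/
theorem log_shell_le {v δ : ℝ} (hv : 1 ≤ v) (hδ : 0 < δ) :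
    ∃ M : ℕ, v ≤ 2 ^ M ∧ Real.log ((M + 1) / (δ / 4))
      ≤ Real.log (16 * Real.logb 2 (√2 * v + 1) / δ) := by
  have hlv : 0 ≤ Real.logb 2 v := Real.logb_nonneg one_lt_two hv
  refine ⟨⌈Real.logb 2 v⌉₊, ?_, ?_⟩
  · rw [← Real.rpow_natCast]
    exact (Real.logb_le_iff_le_rpow one_lt_two (by linarith)).1 (Nat.le_ceil _)
  · refine Real.log_le_log (by positivity) ?_
    rw [div_div_eq_mul_div]
    refine div_le_div_of_nonneg_right ?_ hδ.le
    have h1 : Real.logb 2 v + 1 / 2 ≤ Real.logb 2 (√2 * v + 1) := by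
      have h2 : Real.logb 2 (√2 * v) = Real.logb 2 v + 1 / 2 := by
        rw [Real.logb_mul (by positivity) (by positivity), Real.sqrt_eq_rpow,
          Real.logb_rpow two_pos (by norm_num)]
        ring
      rw [← h2]
      exact Real.logb_le_logb_of_le one_lt_two (by positivity) (by linarith)
    have h3 := (Nat.ceil_lt_add_one hlv).le
    linarith

theorem log_le_log_shell {v δ : ℝ} (hv : 1 ≤ v) (hδ : 0 < δ) {a : ℝ} (ha0 : 0 < a) (ha : a ≤ 16) :
    Real.log (a / δ) ≤ Real.log (16 * Real.logb 2 (√2 * v + 1) / δ) := by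
  have h1 : 1 ≤ Real.logb 2 (√2 * v + 1) := by
    rw [Real.le_logb_iff_rpow_le one_lt_two (by positivity), Real.rpow_one]
    nlinarith [Real.one_le_sqrt.2 (one_le_two (α := ℝ))]
  refine Real.log_le_log (by positivity) ?_
  gcongr
  linarith

theorem ExcessRiskBound.mono {n : ℕ} {δ b b' : ℝ} (h : ExcessRiskBound X Y P f xs n δ b)
    (hb : b ≤ b') : ExcessRiskBound X Y P f xs n δ b' := by
  refine (measure_mono ?_).trans h
  rintro S ⟨xh, yh, hsol, hne⟩
  exact ⟨xh, yh, hsol, fun hle => hne (hle.trans hb)⟩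

/-- What a large sample guarantees: the sizes of the confidence term and of the uniform deviation. -/
theorem largeSample_bounds {n : ℕ} {δ : ℝ} (hβ : 0 < β) (hμx : 0 < μx) (hμy : 0 < μy)
    (hδ : 0 < δ) (hδ1 : δ < 1) (hL : μx ≤ β * (1 + β / μy))
    (h : LargeSample 1280000 β μx μy R₁ d n δ) :
    n ≠ 0 ∧ 8 * Real.log (8 / δ) ≤ n ∧ ∃ M : ℕ, R₁ * n ≤ 2 ^ M ∧
      d + 1 + Real.log ((M + 1) / (δ / 4)) ≤ n ∧
      (1 + β / μy) * (200 * (β * (1 + β / μy))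
        * √((d + 1 + Real.log ((M + 1) / (δ / 4))) / n)) ≤ μx / 4 := by
  obtain ⟨hv, hn⟩ := h
  have hn0 : n ≠ 0 := by rintro rfl; norm_num at hv
  have hnpos : (0 : ℝ) < n := Nat.cast_pos.2 (Nat.pos_of_ne_zero hn0)
  obtain ⟨M, hM, hlogM⟩ := log_shell_le hv hδ
  rw [← mul_assoc] at hlogM
  have h16 := log_le_log_shell hv hδ (a := 16) (by norm_num) le_rfl
  have h8 := log_le_log_shell hv hδ (a := 8) (by norm_num) (by norm_num)
  rw [← mul_assoc] at h16 h8
  set Λ := Real.log (16 * Real.logb 2 (√2 * R₁ * n + 1) / δ)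
  have hΛ : 1 ≤ Λ := by
    refine le_trans ?_ h16
    rw [Real.le_log_iff_exp_le (by positivity), le_div_iff₀ hδ]
    have := Real.exp_one_lt_three
    nlinarith
  set q := 1 + β / μy with hq
  have hq1 : 1 ≤ q := by have : 0 < β / μy := by positivity
                         linarith
  -- In terms of `Q` the sample size condition reads `n ≥ 1280000 Q² (d + Λ)`. Here `1280000 = 2 ·
  -- 800²`: the 2 absorbs the extra `+1` in `U`, and 800 is 4 times the chaining constant 200.
  set Q := β * q * q / μx with hQ
  have hQ1 : 1 ≤ Q := by
    rw [hQ, le_div_iff₀ hμx]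
    nlinarith [mul_pos hβ (by linarith : 0 < q)]
  have hd : (0 : ℝ) ≤ d := d.cast_nonneg
  have e : 1280000 * β ^ 2 * (μy + β) ^ 4 * (d + Λ) / (μy ^ 4 * μx ^ 2)
      = 1280000 * Q ^ 2 * (d + Λ) := by
    rw [hQ, hq]; field_simp
  rw [e] at hn
  have hQ2 : 1 ≤ Q ^ 2 := one_le_pow₀ hQ1
  set U : ℝ := d + 1 + Real.log ((M + 1) / (δ / 4)) with hU
  have hU2 : U ≤ 2 * (d + Λ) := by linarith
  have hn1 : 640000 * Q ^ 2 * U ≤ n := by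
    refine le_trans ?_ hn
    nlinarith
  have hn2 : 1280000 * (d + Λ) ≤ n := by
    refine le_trans ?_ hn
    nlinarith
  refine ⟨hn0, by linarith, M, hM, by linarith, ?_⟩
  have h1 : √(U / n) ≤ 1 / (800 * Q) := by
    rw [Real.sqrt_le_left (by positivity), div_le_iff₀ hnpos, div_pow, one_pow,
      one_div_mul_eq_div, le_div_iff₀ (by positivity)]
    linarith
  calc q * (200 * (β * q) * √(U / n)) ≤ q * (200 * (β * q) * (1 / (800 * Q))) := by gcongr
    _ = μx / 4 := by
      have : 0 < q := by linarith
      rw [hQ]; field_simp; norm_num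

theorem sq_gradient_bound {n l σx2 σy2 a : ℝ} (hβ : 0 < β) (hμx : 0 < μx) (hμy : 0 < μy)
    (hBx : 0 < Bx) (hBy : 0 < By) (hn : 0 < n) (hl : 0 ≤ l) (hσx : 0 ≤ σx2) (hσy : 0 ≤ σy2)
    (ha0 : 0 ≤ a)
    (ha : a ≤ 4 / 3 * (3 / 2 * √σx2 * √(2 * l / n) + Bx * (l / n)
      + β / μy * (3 / 2 * √σy2 * √(2 * l / n) + By * (l / n))) + μx / (3 * n)) :
    1 / (2 * μx) * a ^ 2 ≤ 12 * β ^ 2 * σy2 * l / (μx * μy ^ 2 * n)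
        + 12 * σx2 * l / (μx * n)
        + 3 * (2 * β * By / μy * l + 2 * Bx * l + μx) ^ 2 / (2 * μx * n ^ 2) := by
  have hw2 : √(2 * l / n) ^ 2 = 2 * l / n := Real.sq_sqrt (by positivity)
  have e1 := Real.sq_sqrt hσx
  have e2 := Real.sq_sqrt hσy
  generalize √(2 * l / n) = w at *
  generalize √σx2 = σx at *
  generalize √σy2 = σy at *
  obtain ⟨T, hT⟩ : ∃ T, T = 2 * β * By / μy * l + 2 * Bx * l + μx := ⟨_, rfl⟩
  rw [← hT]
  obtain ⟨p, hp⟩ : ∃ p, p = 2 * σx * w := ⟨_, rfl⟩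
  obtain ⟨q, hq⟩ : ∃ q, q = 2 * (β / μy) * σy * w := ⟨_, rfl⟩
  -- Here `4/3 · 3/2 = 2` is exact, while the terms of order `1/n` are rounded up to those of `T`.
  have h1 : a ≤ p + q + T / n := by
    refine ha.trans ?_
    have e3 : T / n = 2 * (β / μy) * By * (l / n) + 2 * Bx * (l / n) + μx / n := by
      rw [hT]; ring
    have e4 : μx / (3 * n) = μx / n / 3 := by rw [div_div, mul_comm]
    rw [e3, e4, hp, hq]
    have p1 : 0 ≤ β / μy * By * (l / n) := by positivity
    have p2 : 0 ≤ Bx * (l / n) := by positivity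
    have p3 : 0 ≤ μx / n := by positivity
    linarith
  have h2 : a ^ 2 ≤ 3 * (p ^ 2 + q ^ 2 + (T / n) ^ 2) := by
    refine (pow_le_pow_left₀ ha0 h1 2).trans ?_
    nlinarith [sq_nonneg (p - q), sq_nonneg (q - T / n), sq_nonneg (p - T / n)]
  have hp2 : p ^ 2 = 8 * σx2 * l / n := by
    rw [hp, mul_pow, mul_pow, e1, hw2]; ring
  have hq2 : q ^ 2 = 8 * β ^ 2 * σy2 * l / (μy ^ 2 * n) := by
    rw [hq, mul_pow, mul_pow, e2, hw2]; field_simp; ring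
  rw [hp2, hq2] at h2
  calc 1 / (2 * μx) * a ^ 2
      ≤ 1 / (2 * μx) * (3 * (8 * σx2 * l / n + 8 * β ^ 2 * σy2 * l / (μy ^ 2 * n) + (T / n) ^ 2)) := by
        gcongr
    _ = _ := by field_simp; ring

theorem Setting.excessRiskBound (h : Setting X Y P f β μx μy Bx By R₁ xs ys) {n : ℕ} {δ : ℝ}
    (hδ : 0 < δ) (hδ1 : δ < 1) (hLS : LargeSample 1280000 β μx μy R₁ d n δ) :
    ExcessRiskBound X Y P f xs n δ
      (12 * β ^ 2 * (∫ z, ‖gradY Y f xs ys z‖ ^ 2 ∂P) * Real.log (8 / δ) / (μx * μy ^ 2 * n)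
        + 12 * (∫ z, ‖gradX X f xs ys z‖ ^ 2 ∂P) * Real.log (8 / δ) / (μx * n)
        + 3 * (2 * β * By / μy * Real.log (8 / δ) + 2 * Bx * Real.log (8 / δ) + μx) ^ 2
          / (2 * μx * n ^ 2)) := by
  have := h.prob
  have hβ := h.β_pos
  have hμx := h.μx_pos
  have hμy := h.μy_pos
  have hBx := h.Bx_pos
  have hBy := h.By_pos
  set l := Real.log (8 / δ) with hl
  have hl0 : 0 ≤ l := Real.log_nonneg (by rw [le_div_iff₀ hδ]; linarith)
  set σx2 := ∫ z, ‖gradX X f xs ys z‖ ^ 2 ∂P with hσx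
  set σy2 := ∫ z, ‖gradY Y f xs ys z‖ ^ 2 ∂P with hσy
  have hσx0 : 0 ≤ σx2 := integral_nonneg fun z => sq_nonneg _
  have hσy0 : 0 ≤ σy2 := integral_nonneg fun z => sq_nonneg _
  obtain ⟨ystar, hy, he⟩ := h.exists_argmax
  obtain ⟨hxs, hys, -, -⟩ := h.sol
  -- On a one-point `X` the excess risk is zero; otherwise `μx ≤ β(1 + β/μy)` is available.
  by_cases htriv : ∀ x ∈ X, x = xs
  · rw [ExcessRiskBound]
    refine le_of_eq_of_le (measure_eq_zero_iff_ae_notMem.2 ?_) zero_le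
    refine Filter.Eventually.of_forall fun S => ?_
    rintro ⟨xh, yh, hsol, hne⟩
    rw [htriv xh hsol.1, sub_self] at hne
    exact hne (by positivity)
  push Not at htriv
  obtain ⟨x₁, hx₁, hne₁⟩ := htriv
  obtain ⟨hn, h8, M, hM, hU, hε⟩ :=
    largeSample_bounds hβ hμx hμy hδ hδ1 (h.μx_le hy he hx₁ hne₁) hLS
  have hnpos : (0 : ℝ) < n := Nat.cast_pos.2 (Nat.pos_of_ne_zero hn)
  set ε := 200 * (β * (1 + β / μy)) * √((d + 1 + Real.log ((M + 1) / (δ / 4))) / n) with hεdef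
  have hLpos : 0 < β * (1 + β / μy) := by positivity
  -- Four failure events of probability `δ/4`: the pointwise deviations of the two gradients at the
  -- solution, and their uniform deviations along `x ↦ (x, ystar x)`.
  have hexp : 2 * Real.exp (-l) = δ / 4 := by
    rw [Real.exp_neg, hl, Real.exp_log (by positivity)]; field_simp; norm_num
  have b1 := Bernstein.measure_norm_dev_gt_le (h.integrable_gradX hxs hys).aestronglyMeasurable
    hBx.le h.bernstein_x hn hl0 h8
  have b2 := Bernstein.measure_norm_dev_gt_le (h.integrable_gradY hxs hys).aestronglyMeasurable
    hBy.le h.bernstein_y hn hl0 h8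
  rw [hexp] at b1 b2
  have b3 := measure_exists_dev_gt_le (P := P) (h := fun x => gradX X f x (ystar x)) hn hLpos
    (fun x hx => h.integrable_gradX hx (hy x hx).1)
    (fun x hx x' hx' z => h.lipschitz_gradX_argmax hy hx hx' z) (by positivity : 0 < δ / 4)
    (by linarith) hM hxs h.radius hU
  have b4 := measure_exists_dev_gt_le (P := P) (h := fun x => gradY Y f x (ystar x)) hn hLpos
    (fun x hx => h.integrable_gradY hx (hy x hx).1)
    (fun x hx x' hx' z => h.lipschitz_gradY_argmax hy hx hx' z) (by positivity : 0 < δ / 4)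
    (by linarith) hM hxs h.radius hU
  have hsum : ENNReal.ofReal δ = ENNReal.ofReal (δ / 4) + ENNReal.ofReal (δ / 4)
      + ENNReal.ofReal (δ / 4) + ENNReal.ofReal (δ / 4) := by
    rw [← ENNReal.ofReal_add (by positivity) (by positivity),
      ← ENNReal.ofReal_add (by positivity) (by positivity),
      ← ENNReal.ofReal_add (by positivity) (by positivity)]
    congr 1; ring
  rw [ExcessRiskBound, hsum]
  refine le_trans (measure_mono ?_) ((measure_union_le _ _).trans (add_le_add
    ((measure_union_le _ _).trans (add_le_add ((measure_union_le _ _).trans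
      (add_le_add b1 b2)) b3)) b4))
  rintro S ⟨xh, yh, hsol, hbad⟩
  by_contra hgood
  simp only [Set.mem_union, Set.mem_ofPred_eq, not_or, not_lt, not_exists, not_and] at hgood
  obtain ⟨⟨⟨g1, g2⟩, g3⟩, g4⟩ := hgood
  apply hbad
  have g3' := g3 xh hsol.1
  have g4' := g4 xh hsol.1
  rw [mul_right_comm] at g3' g4'
  have hgrad := h.norm_grad_le_of_dev hy hn he hε hsol g1 g2 g3' g4'
  refine (h.primal_pl hy hsol.1).trans ?_
  exact sq_gradient_bound hβ hμx hμy hBx hBy hnpos hl0 hσx0 hσy0 (norm_nonneg _) hgrad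

/-! ### Optimistic rates for nonnegative losses. -/

/-- Constant of the optimistic rate, when the second moments of the partial gradients at the
optimum are at most `A` times the optimal risk. -/
def rateConst (β μx μy Bx By δ₀ A : ℝ) : ℝ :=
  12 * β ^ 2 * |A| * (1 + Real.log 8 / Real.log (1 / δ₀)) / (μx * μy ^ 2)
    + 12 * |A| * (1 + Real.log 8 / Real.log (1 / δ₀)) / μx
    + 3 * (2 * β * By / μy * (1 + Real.log 8 / Real.log (1 / δ₀))
      + 2 * Bx * (1 + Real.log 8 / Real.log (1 / δ₀)) + μx * (1 / Real.log (1 / δ₀))) ^ 2 / (2 * μx)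

theorem Setting.primal_nonneg (h : Setting X Y P f β μx μy Bx By R₁ xs ys)
    (hf : ∀ x ∈ X, ∀ y ∈ Y, ∀ z, 0 ≤ f x y z) : 0 ≤ primal Y (popRisk P f) xs := by
  rw [h.primal_xs]
  exact integral_nonneg fun z => hf xs h.sol.1 ys h.sol.2.1 z

theorem rateConst_nonneg {δ₀ A : ℝ} (hμx : 0 < μx) (hδ₀ : 0 < δ₀)
    (hδ₁ : δ₀ < 1) : 0 ≤ rateConst β μx μy Bx By δ₀ A := by
  have h1 : 0 < Real.log (1 / δ₀) := Real.log_pos (by rw [lt_div_iff₀ hδ₀]; linarith)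
  have h2 : 0 < Real.log 8 := Real.log_pos (by norm_num)
  unfold rateConst
  positivity

theorem Setting.excessRiskBound_rate (h : Setting X Y P f β μx μy Bx By R₁ xs ys)
    (hf : ∀ x ∈ X, ∀ y ∈ Y, ∀ z, 0 ≤ f x y z) {A δ₀ : ℝ}
    (hAx : ∫ z, ‖gradX X f xs ys z‖ ^ 2 ∂P ≤ A * primal Y (popRisk P f) xs)
    (hAy : ∫ z, ‖gradY Y f xs ys z‖ ^ 2 ∂P ≤ A * primal Y (popRisk P f) xs)
    (hδ₀ : 0 < δ₀) (hδ₁ : δ₀ < 1) {n : ℕ} {δ : ℝ} (hδ : 0 < δ) (hle : δ ≤ δ₀)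
    (hLS : LargeSample 1280000 β μx μy R₁ d n δ) :
    ExcessRiskBound X Y P f xs n δ (rateConst β μx μy Bx By δ₀ A *
      (primal Y (popRisk P f) xs * Real.log (1 / δ) / n + Real.log (1 / δ) ^ 2 / n ^ 2)) := by
  have hβ := h.β_pos
  have hμx := h.μx_pos
  have hμy := h.μy_pos
  have hBx := h.Bx_pos
  have hBy := h.By_pos
  refine (h.excessRiskBound hδ (hle.trans_lt hδ₁) hLS).mono ?_
  have hΦ := h.primal_nonneg hf
  have hn : (0 : ℝ) ≤ n := n.cast_nonneg
  unfold rateConst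
  set Φ := primal Y (popRisk P f) xs
  have hl0 : 0 < Real.log (1 / δ₀) := Real.log_pos (by rw [lt_div_iff₀ hδ₀]; linarith)
  have hll : Real.log (1 / δ₀) ≤ Real.log (1 / δ) :=
    Real.log_le_log (by positivity) (one_div_le_one_div_of_le hδ hle)
  have h8 : 0 < Real.log 8 := Real.log_pos (by norm_num)
  have e8 : Real.log (8 / δ) = Real.log 8 + Real.log (1 / δ) := by
    rw [← Real.log_mul (by norm_num) (by positivity), mul_one_div]
  set l := Real.log (1 / δ)
  set l₀ := Real.log (1 / δ₀)
  set q := 1 + Real.log 8 / l₀ with hq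
  have hq0 : 0 < q := by positivity
  -- Since `δ ≤ δ₀ < 1`, constants can be traded for multiples of `l = log (1/δ)`; this is why the
  -- rate constant depends on `δ₀`.
  have hp : 1 ≤ 1 / l₀ * l := by rw [one_div_mul_eq_div, one_le_div hl0]; exact hll
  have hlq : Real.log (8 / δ) ≤ q * l := by
    rw [e8, hq]
    have := mul_le_mul_of_nonneg_left hp h8.le
    have e : Real.log 8 / l₀ * l = Real.log 8 * (1 / l₀ * l) := by ring
    linarith
  have hlδ : 0 ≤ Real.log (8 / δ) := by linarith
  have hAΦ : A * Φ ≤ |A| * Φ := mul_le_mul_of_nonneg_right (le_abs_self A) hΦ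
  have hx := hAx.trans hAΦ
  have hyy := hAy.trans hAΦ
  have hl : 0 ≤ l := hl0.le.trans hll
  have t1 : 12 * β ^ 2 * (∫ z, ‖gradY Y f xs ys z‖ ^ 2 ∂P) * Real.log (8 / δ) / (μx * μy ^ 2 * n)
      ≤ 12 * β ^ 2 * (|A| * Φ) * (q * l) / (μx * μy ^ 2 * n) := by gcongr
  have t2 : 12 * (∫ z, ‖gradX X f xs ys z‖ ^ 2 ∂P) * Real.log (8 / δ) / (μx * n)
      ≤ 12 * (|A| * Φ) * (q * l) / (μx * n) := by gcongr
  have t3 : 3 * (2 * β * By / μy * Real.log (8 / δ) + 2 * Bx * Real.log (8 / δ) + μx) ^ 2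
          / (2 * μx * n ^ 2)
      ≤ 3 * (2 * β * By / μy * (q * l) + 2 * Bx * (q * l) + μx * (1 / l₀ * l)) ^ 2
          / (2 * μx * n ^ 2) := by
    gcongr
    exact le_mul_of_one_le_right hμx.le hp
  refine (add_le_add (add_le_add t1 t2) t3).trans ?_
  set K₁ := 12 * β ^ 2 * |A| * q / (μx * μy ^ 2) with hK₁
  set K₂ := 12 * |A| * q / μx with hK₂
  set K₃ := 3 * (2 * β * By / μy * q + 2 * Bx * q + μx * (1 / l₀)) ^ 2 / (2 * μx) with hK₃
  have e1 : 12 * β ^ 2 * (|A| * Φ) * (q * l) / (μx * μy ^ 2 * n) = K₁ * (Φ * l / n) := by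
    rw [hK₁, div_mul_div_comm]; ring
  have e2 : 12 * (|A| * Φ) * (q * l) / (μx * n) = K₂ * (Φ * l / n) := by
    rw [hK₂, div_mul_div_comm]; ring
  have e3 : 3 * (2 * β * By / μy * (q * l) + 2 * Bx * (q * l) + μx * (1 / l₀ * l)) ^ 2
      / (2 * μx * n ^ 2) = K₃ * (l ^ 2 / n ^ 2) := by
    rw [hK₃, div_mul_div_comm]; ring
  rw [e1, e2, e3]
  have hK1 : 0 ≤ K₁ := by positivity
  have hK2 : 0 ≤ K₂ := by positivity
  have hK3 : 0 ≤ K₃ := by positivity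
  have hr1 : 0 ≤ Φ * l / n := by positivity
  have hr2 : 0 ≤ l ^ 2 / (n : ℝ) ^ 2 := by positivity
  linarith [mul_nonneg hK1 hr2, mul_nonneg hK2 hr2, mul_nonneg hK3 hr1]

theorem Setting.excessRiskBound_fast_rate (h : Setting X Y P f β μx μy Bx By R₁ xs ys)
    (hf : ∀ x ∈ X, ∀ y ∈ Y, ∀ z, 0 ≤ f x y z) {A δ₀ M : ℝ}
    (hAx : ∫ z, ‖gradX X f xs ys z‖ ^ 2 ∂P ≤ A * primal Y (popRisk P f) xs)
    (hAy : ∫ z, ‖gradY Y f xs ys z‖ ^ 2 ∂P ≤ A * primal Y (popRisk P f) xs)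
    (hδ₀ : 0 < δ₀) (hδ₁ : δ₀ < 1) {n : ℕ} {δ : ℝ} (hδ : 0 < δ) (hle : δ ≤ δ₀)
    (hLS : LargeSample 1280000 β μx μy R₁ d n δ) (hM : primal Y (popRisk P f) xs ≤ M / n) :
    ExcessRiskBound X Y P f xs n δ (rateConst β μx μy Bx By δ₀ A *
      (|M| * (1 / Real.log (1 / δ₀)) + 1) * (Real.log (1 / δ) ^ 2 / n ^ 2)) := by
  refine (h.excessRiskBound_rate hf hAx hAy hδ₀ hδ₁ hδ hle hLS).mono ?_
  rw [mul_assoc]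
  refine mul_le_mul_of_nonneg_left ?_ (rateConst_nonneg h.μx_pos hδ₀ hδ₁)
  have hl0 : 0 < Real.log (1 / δ₀) := Real.log_pos (by rw [lt_div_iff₀ hδ₀]; linarith)
  have hll : Real.log (1 / δ₀) ≤ Real.log (1 / δ) :=
    Real.log_le_log (by positivity) (one_div_le_one_div_of_le hδ hle)
  set l := Real.log (1 / δ)
  set l₀ := Real.log (1 / δ₀)
  have hl : 0 ≤ l := hl0.le.trans hll
  have hp : 1 ≤ 1 / l₀ * l := by rw [one_div_mul_eq_div, one_le_div hl0]; exact hll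
  have hn : (0 : ℝ) ≤ n := n.cast_nonneg
  rw [add_mul, one_mul]
  gcongr ?_ + _
  calc primal Y (popRisk P f) xs * l / n ≤ |M| / n * l / n := by
        gcongr
        exact hM.trans (by gcongr; exact le_abs_self M)
    _ = |M| * (l / n ^ 2) * 1 := by ring
    _ ≤ |M| * (l / n ^ 2) * (1 / l₀ * l) := by gcongr
    _ = _ := by ring

/-- Zero optimal risk of a nonnegative loss forces the gradients at the optimum to vanish. -/
theorem Setting.gradients_eq_zero (h : Setting X Y P f β μx μy Bx By R₁ xs ys)
    (hf : ∀ x ∈ X, ∀ y ∈ Y, ∀ z, 0 ≤ f x y z) (h0 : primal Y (popRisk P f) xs = 0) :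
    (∀ᵐ z ∂P, gradX X f xs ys z = 0) ∧ ∀ z, gradY Y f xs ys z = 0 := by
  have := h.prob
  obtain ⟨hxs, hys, -, hmax⟩ := h.sol
  obtain ⟨ystar, hy, -⟩ := h.exists_argmax
  rw [h.primal_xs] at h0
  constructor
  · have hf0 : ∀ᵐ z ∂P, f xs ys z = 0 :=
      (integral_eq_zero_iff_of_nonneg (fun z => hf xs hxs ys hys z)
        (h.integrable xs hxs ys hys)).1 h0
    -- For almost every `z`, the nonnegative `f(·, ys; z)` vanishes at `xs`, which is therefore a
    -- minimizer over `X`.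
    have hvar : ∀ᵐ z ∂P, ∀ x ∈ X, 0 ≤ inner ℝ (gradX X f xs ys z) (x - xs) := by
      filter_upwards [hf0] with z hz x hx
      suffices hs : -inner ℝ (gradX X f xs ys z) (x - xs) ≤ 0 by linarith
      refine le_zero_of_forall_le_mul (C := β / 2 * ‖x - xs‖ ^ 2) fun t ht0 ht1 => ?_
      have hm : xs + t • (x - xs) ∈ X := h.convex_X.add_smul_sub_mem hxs hx ⟨ht0.le, ht1.le⟩
      have h1 := (abs_le.1 ((h.scSmooth z).expand_x ys hys xs hxs _ hm)).2
      have h2 := hf _ hm ys hys z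
      rw [add_sub_cancel_left, inner_smul_right, norm_smul, Real.norm_of_nonneg ht0.le, hz] at h1
      have h3 : t * -inner ℝ (gradX X f xs ys z) (x - xs) ≤ t * (t * (β / 2 * ‖x - xs‖ ^ 2)) := by
        linarith
      exact le_of_mul_le_mul_left h3 ht0
    obtain ⟨x₀, hx₀⟩ := h.interior_X
    have hint : Integrable (fun z => inner ℝ (gradX X f xs ys z) (x₀ - xs)) P :=
      (h.integrable_gradX hxs hys).inner_const _
    -- The mean gradient vanishes, so this nonnegative inner product is zero almost surely. As `x₀`
    -- is interior, a small move along `-g` then forces `g = 0`.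
    have hzero : ∫ z, inner ℝ (gradX X f xs ys z) (x₀ - xs) ∂P = 0 := by
      simp_rw [real_inner_comm (x₀ - xs)]
      rw [integral_inner (h.integrable_gradX hxs hys)]
      have := h.popGradX_xs hy
      rw [popGradX] at this
      rw [this, inner_zero_right]
    have hz0 := (integral_eq_zero_iff_of_nonneg_ae
      (by filter_upwards [hvar] with z hz using hz x₀ (interior_subset hx₀)) hint).1 hzero
    filter_upwards [hvar, hz0] with z hz hz0
    set g := gradX X f xs ys z
    have hcont : Filter.Tendsto (fun t : ℝ => x₀ - t • g) (nhds 0) (nhds (x₀ - (0 : ℝ) • g)) :=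
      Continuous.tendsto (by fun_prop) 0
    rw [zero_smul, sub_zero] at hcont
    have hev := (hcont.eventually (mem_interior_iff_mem_nhds.1 hx₀)).filter_mono
      (nhdsWithin_le_nhds (s := Set.Ioi 0))
    obtain ⟨t, ht, ht0⟩ := (hev.and self_mem_nhdsWithin).exists
    have h1 := hz _ ht
    have h2 : inner ℝ g (x₀ - xs) = 0 := hz0
    rw [show x₀ - t • g - xs = (x₀ - xs) - t • g by abel, inner_sub_right, h2, inner_smul_right,
      real_inner_self_eq_norm_sq] at h1
    have ht0 : 0 < t := ht0
    have h3 : ‖g‖ ^ 2 ≤ 0 := by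
      by_contra! h4
      have := mul_pos ht0 h4
      linarith
    exact norm_eq_zero.1 (pow_eq_zero_iff two_ne_zero |>.1 (le_antisymm h3 (sq_nonneg _)))
  -- `F(xs, ·)` is nonnegative with maximum zero, hence constant, and strong concavity leaves one
  -- point. A singleton with nonempty interior means `d' = 0`.
  · have hY : Y = {ys} := by
      refine Set.Subset.antisymm (fun y hyY => ?_) (Set.singleton_subset_iff.2 hys)
      have hsc := h.scSmooth_popRisk
      have h1 : 0 ≤ popRisk P f xs y := integral_nonneg fun z => hf xs hxs y hyY z
      have h2 := hsc.concave_y xs hxs ys hys y hyY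
      have h3 := hsc.variational_y h.convex_Y hxs hys hmax hyY
      have h4 : μy / 2 * ‖y - ys‖ ^ 2 ≤ 0 := by linarith
      have h5 : ‖y - ys‖ ^ 2 ≤ 0 := by
        have := h.μy_pos
        nlinarith
      exact sub_eq_zero.1 (norm_eq_zero.1
        (pow_eq_zero_iff two_ne_zero |>.1 (le_antisymm h5 (sq_nonneg _))))
    intro z
    rcases subsingleton_or_nontrivial (E d') with hs | hs
    · exact Subsingleton.elim _ _
    · have := h.interior_Y
      rw [hY, interior_singleton] at this
      exact absurd this Set.not_nonempty_empty

theorem Setting.exists_moment_bound (h : Setting X Y P f β μx μy Bx By R₁ xs ys)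
    (hf : ∀ x ∈ X, ∀ y ∈ Y, ∀ z, 0 ≤ f x y z) : ∃ A : ℝ,
    ∫ z, ‖gradX X f xs ys z‖ ^ 2 ∂P ≤ A * primal Y (popRisk P f) xs ∧
    ∫ z, ‖gradY Y f xs ys z‖ ^ 2 ∂P ≤ A * primal Y (popRisk P f) xs := by
  rcases (h.primal_nonneg hf).eq_or_lt with h0 | hpos
  · obtain ⟨hx, hy⟩ := h.gradients_eq_zero hf h0.symm
    refine ⟨0, ?_, by simp [hy]⟩
    have e : (fun z => ‖gradX X f xs ys z‖ ^ 2) =ᵐ[P] fun _ => 0 := by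
      filter_upwards [hx] with z hz
      simp [hz]
    rw [integral_congr_ae e]
    simp
  · refine ⟨(∫ z, ‖gradX X f xs ys z‖ ^ 2 ∂P + ∫ z, ‖gradY Y f xs ys z‖ ^ 2 ∂P)
      / primal Y (popRisk P f) xs, ?_, ?_⟩ <;> rw [div_mul_cancel₀ _ hpos.ne']
    · have : 0 ≤ ∫ z, ‖gradY Y f xs ys z‖ ^ 2 ∂P := integral_nonneg fun z => sq_nonneg _
      linarith
    · have : 0 ≤ ∫ z, ‖gradX X f xs ys z‖ ^ 2 ∂P := integral_nonneg fun z => sq_nonneg _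
      linarith

/-- Self-bounding property of nonnegative smooth functions. -/
theorem norm_sq_le_of_nonneg {k : ℕ} {φ : E k → ℝ} {x g : E k} (hβ : 0 < β) (hφ : ∀ x, 0 ≤ φ x)
    (h : ∀ x', |φ x' - φ x - inner ℝ g (x' - x)| ≤ β / 2 * ‖x' - x‖ ^ 2) :
    ‖g‖ ^ 2 ≤ 2 * β * φ x := by
  -- One gradient step of length `1/β` decreases `φ` by at least `‖g‖²/(2β)`, yet `φ` stays
  -- nonnegative.
  have h1 := (abs_le.1 (h (x - β⁻¹ • g))).2
  have h2 := hφ (x - β⁻¹ • g)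
  rw [show x - β⁻¹ • g - x = -(β⁻¹ • g) by abel, norm_neg, norm_smul, inner_neg_right,
    inner_smul_right, real_inner_self_eq_norm_sq, Real.norm_of_nonneg (by positivity)] at h1
  have e : β / 2 * (β⁻¹ * ‖g‖) ^ 2 = β⁻¹ * ‖g‖ ^ 2 / 2 := by field_simp
  rw [e] at h1
  have h3 : β⁻¹ * ‖g‖ ^ 2 ≤ 2 * φ x := by linarith
  rw [inv_mul_le_iff₀ hβ] at h3
  linarith

theorem Setting.moment_bound_of_smooth (h : Setting X Y P f β μx μy Bx By R₁ xs ys)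
    (hsm : IsSmoothOn β Set.univ Set.univ f) (hf : ∀ x y z, 0 ≤ f x y z) :
    ∫ z, ‖gradX X f xs ys z‖ ^ 2 ∂P ≤ 2 * β * primal Y (popRisk P f) xs ∧
    ∫ z, ‖gradY Y f xs ys z‖ ^ 2 ∂P ≤ 2 * β * primal Y (popRisk P f) xs := by
  obtain ⟨hxs, hys, -, -⟩ := h.sol
  have hβ := h.β_pos
  rw [h.primal_xs, popRisk, ← integral_const_mul]
  have hint := (h.integrable xs hxs ys hys).const_mul (2 * β)
  -- The self-bounding step may leave `X`, so it needs the gradient on the whole space, which agrees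
  -- with the relative one because `X` has interior.
  have hX : ∀ z, gradX X f xs ys z = gradX Set.univ f xs ys z := fun z =>
    gradientWithin_eq_of_quadratic (φ := fun x' => f x' ys z) h.convex_X h.interior_X hxs
      fun x' _ => hsm.expand_x hβ.le convex_univ (Set.mem_univ _) (Set.mem_univ x')
        (Set.mem_univ _) z
  have hY : ∀ z, gradY Y f xs ys z = gradY Set.univ f xs ys z := fun z =>
    gradientWithin_eq_of_quadratic (φ := fun y' => f xs y' z) h.convex_Y h.interior_Y hys
      fun y' _ => hsm.expand_y hβ.le convex_univ (Set.mem_univ _) (Set.mem_univ _)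
        (Set.mem_univ y') z
  constructor
  · refine integral_mono (h.bernstein_x 2 le_rfl).1 hint fun z => ?_
    simp only [hX]
    exact norm_sq_le_of_nonneg (φ := fun x' => f x' ys z) hβ (fun x' => hf x' ys z) fun x' =>
      hsm.expand_x hβ.le convex_univ (Set.mem_univ _) (Set.mem_univ x') (Set.mem_univ _) z
  · refine integral_mono (h.bernstein_y 2 le_rfl).1 hint fun z => ?_
    simp only [hY]
    exact norm_sq_le_of_nonneg (φ := fun y' => f xs y' z) hβ (fun y' => hf xs y' z) fun y' =>
      hsm.expand_y hβ.le convex_univ (Set.mem_univ _) (Set.mem_univ _) (Set.mem_univ y') z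

end Problem

end Minimax

end
open Minimax in
theorem theorem4 :
    ∃ c : ℝ, 0 < c ∧
    -- the explicit bound
    (∀ (d d' : ℕ) (Z : Type u) [MeasurableSpace Z] (P : Measure Z)
      (X : Set (E d)) (Y : Set (E d')) (f : E d → E d' → Z → ℝ)
      (β μx μy Bx By R₁ : ℝ) (xs : E d) (ys : E d'),
      Setting X Y P f β μx μy Bx By R₁ xs ys →
      ∀ (n : ℕ) (δ : ℝ), 0 < δ → δ < 1 → LargeSample c β μx μy R₁ d n δ →
        ExcessRiskBound X Y P f xs n δ
          (12 * β ^ 2 * (∫ z, ‖gradY Y f xs ys z‖ ^ 2 ∂P) * Real.log (8 / δ)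
              / (μx * μy ^ 2 * n)
            + 12 * (∫ z, ‖gradX X f xs ys z‖ ^ 2 ∂P) * Real.log (8 / δ) / (μx * n)
            + 3 * (2 * β * By / μy * Real.log (8 / δ) + 2 * Bx * Real.log (8 / δ) + μx) ^ 2
              / (2 * μx * n ^ 2))) ∧
    -- `f ≥ 0` on `X × Y`: constants independent of `n` and `δ`
    (∀ (d d' : ℕ) (Z : Type u) [MeasurableSpace Z] (P : Measure Z)
      (X : Set (E d)) (Y : Set (E d')) (f : E d → E d' → Z → ℝ)
      (β μx μy Bx By R₁ : ℝ) (xs : E d) (ys : E d'),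
      Setting X Y P f β μx μy Bx By R₁ xs ys →
      (∀ x ∈ X, ∀ y ∈ Y, ∀ z, 0 ≤ f x y z) →
      ∀ δ₀ : ℝ, 0 < δ₀ → δ₀ < 1 →
      (∃ K : ℝ, ∀ (n : ℕ) (δ : ℝ), 0 < δ → δ ≤ δ₀ → LargeSample c β μx μy R₁ d n δ →
        ExcessRiskBound X Y P f xs n δ
          (K * (primal Y (popRisk P f) xs * Real.log (1 / δ) / n
            + Real.log (1 / δ) ^ 2 / n ^ 2))) ∧
      (∀ M : ℝ, ∃ K : ℝ, ∀ (n : ℕ) (δ : ℝ), 0 < δ → δ ≤ δ₀ →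
        LargeSample c β μx μy R₁ d n δ → primal Y (popRisk P f) xs ≤ M / n →
        ExcessRiskBound X Y P f xs n δ (K * (Real.log (1 / δ) ^ 2 / n ^ 2)))) ∧
    -- `f ≥ 0` and `β`-smooth on the whole space: constants that are uniform over all problems
    (∀ β μx μy Bx By δ₀ : ℝ, 0 < δ₀ → δ₀ < 1 →
      (∃ K : ℝ, ∀ (d d' : ℕ) (Z : Type u) [MeasurableSpace Z] (P : Measure Z)
        (X : Set (E d)) (Y : Set (E d')) (f : E d → E d' → Z → ℝ)
        (R₁ : ℝ) (xs : E d) (ys : E d'),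
        Setting X Y P f β μx μy Bx By R₁ xs ys →
        IsSmoothOn β Set.univ Set.univ f → (∀ x y z, 0 ≤ f x y z) →
        ∀ (n : ℕ) (δ : ℝ), 0 < δ → δ ≤ δ₀ → LargeSample c β μx μy R₁ d n δ →
          ExcessRiskBound X Y P f xs n δ
            (K * (primal Y (popRisk P f) xs * Real.log (1 / δ) / n
              + Real.log (1 / δ) ^ 2 / n ^ 2))) ∧
      (∀ M : ℝ, ∃ K : ℝ, ∀ (d d' : ℕ) (Z : Type u) [MeasurableSpace Z] (P : Measure Z)
        (X : Set (E d)) (Y : Set (E d')) (f : E d → E d' → Z → ℝ)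
        (R₁ : ℝ) (xs : E d) (ys : E d'),
        Setting X Y P f β μx μy Bx By R₁ xs ys →
        IsSmoothOn β Set.univ Set.univ f → (∀ x y z, 0 ≤ f x y z) →
        ∀ (n : ℕ) (δ : ℝ), 0 < δ → δ ≤ δ₀ → LargeSample c β μx μy R₁ d n δ →
          primal Y (popRisk P f) xs ≤ M / n →
          ExcessRiskBound X Y P f xs n δ (K * (Real.log (1 / δ) ^ 2 / n ^ 2)))) := by
  refine ⟨1280000, by norm_num, ?_, ?_, ?_⟩
  · intro d d' Z _ P X Y f β μx μy Bx By R₁ xs ys h n δ hδ hδ1 hLS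
    exact h.excessRiskBound hδ hδ1 hLS
  · intro d d' Z _ P X Y f β μx μy Bx By R₁ xs ys h hf δ₀ hδ₀ hδ₁
    obtain ⟨A, hAx, hAy⟩ := h.exists_moment_bound hf
    refine ⟨⟨_, fun n δ hδ hle hLS => h.excessRiskBound_rate hf hAx hAy hδ₀ hδ₁ hδ hle hLS⟩,
      fun M => ⟨_, fun n δ hδ hle hLS hM =>
        h.excessRiskBound_fast_rate hf hAx hAy hδ₀ hδ₁ hδ hle hLS hM⟩⟩
  · intro β μx μy Bx By δ₀ hδ₀ hδ₁
    refine ⟨⟨rateConst β μx μy Bx By δ₀ (2 * β), ?_⟩, fun M =>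
      ⟨rateConst β μx μy Bx By δ₀ (2 * β) * (|M| * (1 / Real.log (1 / δ₀)) + 1), ?_⟩⟩
    · intro d d' Z _ P X Y f R₁ xs ys h hsm hf n δ hδ hle hLS
      obtain ⟨hAx, hAy⟩ := h.moment_bound_of_smooth hsm hf
      exact h.excessRiskBound_rate (fun x _ y _ z => hf x y z) hAx hAy hδ₀ hδ₁ hδ hle hLS
    · intro d d' Z _ P X Y f R₁ xs ys h hsm hf n δ hδ hle hLS hM
      obtain ⟨hAx, hAy⟩ := h.moment_bound_of_smooth hsm hf
      exact h.excessRiskBound_fast_rate (fun x _ y _ z => hf x y z) hAx hAy hδ₀ hδ₁ hδ hle hLS hM
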